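/- Let $p\ge 2$ be real, $A\in\mathbb R^{d\times n}$, $b\in\mathbb R^d$ such that $\{x: Ax=b\}\neq\emptyset$, and $0<\varepsilon\le\frac12$. The algorithm below accesses $b$ only through a solver for linear systems $ADA^\top\phi=b$, which receives a non-negative diagonal matrix $D$ and returns some solution $\phi$ if there is one. For $r\in\mathbb R^n_{>0}$ let $x(r)=DA^\top\phi$ with $D=\mathrm{diag}(1/r)$ and $ADA^\top\phi=b$; this is $\arg\min_{Ax=b}\sum_i r_ix_i^2$, computed with one call to the solver. Let $c\in(0,1]$ be an absolute constant and $\delta=c\varepsilon$; for $p>2$ let $q=\frac{p}{p-2}$. Algorithm. Compute $x_0=x(\mathbf 1)$, the minimum $\ell_2$-norm solution. If $p=2$ or $x_0=0$, return $x_0$. Otherwise let $L$ be the largest integer with $(1+\delta)^L\le \|x_0\|_2/n^{\frac12-\frac1p}$, $U$ the smallest integer with $(1+\delta)^U\ge\|x_0\|_2$, and $x=x_0$. While $L<U$: let $P=\lfloor (L+U)/2\rfloor$ and solve the subproblem with guess $M=(1+\delta)^P$; if its outcome is a dual vector set $L=P+1$; if it is a primal vector $y$ set $U=P$, $x=y$.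 Return $x$. Subproblem with guess $M$. Start with $r_i=n^{-1/q}$ for all $i$, $s=0$, $m=0$. While $\|r\|_q\le 1/\varepsilon$: let $x=x(r)$, $\rho_i=x_i^2\|r\|_q^{q-1}/r_i^{q-1}$, and $\gamma_i=\rho_i/M^2$ if $\rho_i\ge(1+\delta)M^2$, $\gamma_i=1$ otherwise. If all $\gamma_i=1$, return the primal vector $x$. Let $\alpha_i=\gamma_i^{1/q}$ and replace $r_i$ by $\alpha_ir_i$. If all $\alpha_i\le n^{\frac{2}{2q+1}}(1/\varepsilon)^{\frac{q-1}{2q+1}}$, replace $s$ by $s+x$ and $m$ by $m+1$. If $m>0$ and $\|s/m\|_p\le(1+\delta)M$, return the primal vector $s/m$. When the loop ends, return the dual vector $r$. Theorem. There are absolute constants $c\in(0,1]$ and $C>0$ such that for all $p,d,n,A,b,\varepsilon$ and every solver as above the algorithm terminates, and: 1. it returns $x$ with $Ax=b$ and $\|x\|_p\le(1+\varepsilon)\min_{Ay=b}\|y\|_p$; 2. the number of subproblems it solves is at most $C\left(\log\log n+\log\frac1\varepsilon\right)$ (where $\log\log n$ is read as $0$ for $n\le1$), and it is $0$ if $p=2$;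 3. if $p>2$, each subproblem, with guess $M$, makes at most $$C\left(\left(\tfrac1\varepsilon\right)^{\frac{2p-3}{p-2}}+n^{\frac{p-2}{3p-2}}\left(\tfrac1\varepsilon\right)^{\frac{3p^2-4p}{3p^2-8p+4}}\right)\log\left(\frac{n}{\varepsilon^{p/(p-2)}}\right)$$ calls to the linear system solver, and its outcome is either a primal vector $y$ with $Ay=b$ and $\|y\|_p\le(1+\varepsilon)M$, or a nonzero dual vector $r\ge0$ with $\min_{Ay=b}\sum_i r_iy_i^2\ge\left(\frac{M}{1+\varepsilon}\right)^2\|r\|_q$. -/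

import Mathlib

open Matrix

noncomputable section

namespace IRLS

/-- The `ℓ_s` norm of a vector of `ℝⁿ` (Mathlib's norm on `PiLp s`). -/
def lpNorm {n : ℕ} (s : ℝ) (v : Fin n → ℝ) : ℝ :=
  ‖WithLp.toLp (ENNReal.ofReal s) v‖

/-- A solver for the linear systems `A D Aᵀ φ = b`, where `D` is any non-negative diagonal
matrix (given by its diagonal): it returns a solution whenever there is one. -/
def IsSolver {d n : ℕ} (A : Matrix (Fin d) (Fin n) ℝ) (b : Fin d → ℝ)
    (solve : (Fin n → ℝ) → (Fin d → ℝ)) : Prop :=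
  ∀ D : Fin n → ℝ, (∀ i, 0 ≤ D i) →
    (∃ φ : Fin d → ℝ, (A * Matrix.diagonal D * Aᵀ) *ᵥ φ = b) →
    (A * Matrix.diagonal D * Aᵀ) *ᵥ solve D = b

/-- Weighted least squares with one call to the solver: for `r > 0` the vector
`D Aᵀ φ`, with `D = diag (1 / r)` and `A D Aᵀ φ = b`, minimizes `⟨r, x²⟩` over `A x = b`. -/
def wls {d n : ℕ} (A : Matrix (Fin d) (Fin n) ℝ) (solve : (Fin n → ℝ) → (Fin d → ℝ))
    (r : Fin n → ℝ) : Fin n → ℝ :=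
  let D : Fin n → ℝ := fun i => 1 / r i
  fun i => D i * (Aᵀ *ᵥ solve D) i

/-- The exponent `q = p / (p - 2)`, dual to `p / 2`. -/
def dualExp (p : ℝ) : ℝ := p / (p - 2)

/-- The answer of the subproblem solver: a primal vector, or a dual vector that is meant to
certify that the guess is (approximately) infeasible. -/
inductive Outcome (n : ℕ) : Type
  | primal (x : Fin n → ℝ) : Outcome n
  | dual (r : Fin n → ℝ) : Outcome n

/-- The loop variables of the subproblem solver: the dual vector `r`, the sum `s` of the
primal vectors of the `m` iterations so far in which `r` changed little. -/
structure SubState (n : ℕ) : Type where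
  r : Fin n → ℝ
  s : Fin n → ℝ
  m : ℕ

/-- The ratio `x_i² ‖r‖_q^{q-1} / r_i^{q-1}` that is compared with the squared guess. -/
def congestion {n : ℕ} (p : ℝ) (r x : Fin n → ℝ) (i : Fin n) : ℝ :=
  (x i) ^ 2 * lpNorm (dualExp p) r ^ (dualExp p - 1) / (r i) ^ (dualExp p - 1)

/-- The factors `γ_i`. -/
def gam {n : ℕ} (p δ M : ℝ) (r x : Fin n → ℝ) (i : Fin n) : ℝ :=
  if (1 + δ) * M ^ 2 ≤ congestion p r x i then congestion p r x i / M ^ 2 else 1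

/-- The multiplicative updates `α_i = γ_i^{1/q}`. -/
def alph {n : ℕ} (p δ M : ℝ) (r x : Fin n → ℝ) (i : Fin n) : ℝ :=
  gam p δ M r x i ^ (1 / dualExp p)

/-- The threshold `n^{2/(2q+1)} (1/ε)^{(q-1)/(2q+1)}` below which an update counts as small. -/
def smallStep (n : ℕ) (p ε : ℝ) : ℝ :=
  (n : ℝ) ^ (2 / (2 * dualExp p + 1)) * (1 / ε) ^ ((dualExp p - 1) / (2 * dualExp p + 1))

/-- The loop of the subproblem solver, cut off after `fuel` rounds. It returns the outcome and
the number of calls to the linear system solver, or `none` if the fuel did not suffice.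
Every round makes one call, through `wls`, unless the loop condition `‖r‖_q ≤ 1/ε` fails. -/
def subLoop {d n : ℕ} (A : Matrix (Fin d) (Fin n) ℝ) (solve : (Fin n → ℝ) → (Fin d → ℝ))
    (p ε δ M : ℝ) : (fuel : ℕ) → SubState n → Option (Outcome n × ℕ)
  | 0, _ => none
  | k + 1, st =>
    if lpNorm (dualExp p) st.r ≤ 1 / ε then
      let x := wls A solve st.r
      if ∀ i, gam p δ M st.r x i = 1 then
        some (Outcome.primal x, 1)
      else
        let r' : Fin n → ℝ := fun i => st.r i * alph p δ M st.r x i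
        let small : Prop := ∀ i, alph p δ M st.r x i ≤ smallStep n p ε
        let s' : Fin n → ℝ := if small then st.s + x else st.s
        let m' : ℕ := if small then st.m + 1 else st.m
        let avg : Fin n → ℝ := fun i => s' i / (m' : ℝ)
        if 0 < m' ∧ lpNorm p avg ≤ (1 + δ) * M then
          some (Outcome.primal avg, 1)
        else
          (subLoop A solve p ε δ M k ⟨r', s', m'⟩).map fun o => (o.1, o.2 + 1)
    else
      some (Outcome.dual st.r, 0)

/-- The subproblem solver for the guess `M`, started from the uniform dual vector
`n^{-1/q}`. -/
def subSolver {d n : ℕ} (A : Matrix (Fin d) (Fin n) ℝ) (solve : (Fin n → ℝ) → (Fin d → ℝ))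
    (p ε δ M : ℝ) (fuel : ℕ) : Option (Outcome n × ℕ) :=
  subLoop A solve p ε δ M fuel ⟨fun _ => 1 / (n : ℝ) ^ (1 / dualExp p), 0, 0⟩

/-- The record of one subproblem: the guess, the outcome, and the number of calls to the linear
system solver that were made for it. -/
structure SubCall (n : ℕ) : Type where
  guess : ℝ
  outcome : Outcome n
  calls : ℕ

/-- Binary search over the guesses `(1 + δ)^i`, `L ≤ i ≤ U`, with the current vector `x`.
It returns the final vector and the records of the subproblems that were solved. -/
def searchLoop {d n : ℕ} (A : Matrix (Fin d) (Fin n) ℝ) (solve : (Fin n → ℝ) → (Fin d → ℝ))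
    (p ε δ : ℝ) (subFuel : ℕ) :
    (fuel : ℕ) → (L U : ℤ) → (x : Fin n → ℝ) → Option ((Fin n → ℝ) × List (SubCall n))
  | 0, _, _, _ => none
  | k + 1, L, U, x =>
    if L < U then
      let P : ℤ := (L + U) / 2
      let M : ℝ := (1 + δ) ^ P
      match subSolver A solve p ε δ M subFuel with
      | none => none
      | some (Outcome.dual r, c) =>
        (searchLoop A solve p ε δ subFuel k (P + 1) U x).map
          fun o => (o.1, ⟨M, Outcome.dual r, c⟩ :: o.2)
      | some (Outcome.primal y, c) =>
        (searchLoop A solve p ε δ subFuel k L P y).map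
          fun o => (o.1, ⟨M, Outcome.primal y, c⟩ :: o.2)
    else
      some (x, [])

/-- The whole algorithm: one call to the linear system solver yields the minimum `ℓ₂` norm
solution `x₀`, which is returned if `p = 2` or `x₀ = 0`; otherwise binary search from the largest
`i` with `(1 + δ)^i ≤ ‖x₀‖₂ / n^{1/2-1/p}` to the smallest `i` with `(1 + δ)^i ≥ ‖x₀‖₂`. -/
def lpMin {d n : ℕ} (A : Matrix (Fin d) (Fin n) ℝ) (solve : (Fin n → ℝ) → (Fin d → ℝ))
    (p ε δ : ℝ) (fuel : ℕ) : Option ((Fin n → ℝ) × List (SubCall n)) :=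
  let x₀ : Fin n → ℝ := wls A solve (fun _ => 1)
  if p = 2 ∨ x₀ = 0 then
    some (x₀, [])
  else
    searchLoop A solve p ε δ fuel fuel
      ⌊Real.logb (1 + δ) (lpNorm 2 x₀ / (n : ℝ) ^ (1 / 2 - 1 / p))⌋
      ⌈Real.logb (1 + δ) (lpNorm 2 x₀)⌉ x₀

/-- What it means to solve the subproblem with guess `M` to accuracy `ε`: either a feasible
vector of norm at most `(1 + ε) M`, or a non-negative nonzero `r` with
`min_{A y = b} ⟨r, y²⟩ / ‖r‖_q ≥ (M / (1 + ε))²`. -/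
def Outcome.Solves {d n : ℕ} (A : Matrix (Fin d) (Fin n) ℝ) (b : Fin d → ℝ) (p ε M : ℝ) :
    Outcome n → Prop
  | Outcome.primal x => A *ᵥ x = b ∧ lpNorm p x ≤ (1 + ε) * M
  | Outcome.dual r => (∀ i, 0 ≤ r i) ∧ r ≠ 0 ∧
      ∀ y : Fin n → ℝ, A *ᵥ y = b →
        (M / (1 + ε)) ^ 2 * lpNorm (dualExp p) r ≤ ∑ i, r i * (y i) ^ 2

/-- The bound on the number of linear system solves per subproblem. -/
def callBound (n : ℕ) (p ε : ℝ) : ℝ :=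
  ((1 / ε) ^ ((2 * p - 3) / (p - 2)) +
    (n : ℝ) ^ ((p - 2) / (3 * p - 2)) *
      (1 / ε) ^ ((3 * p ^ 2 - 4 * p) / (3 * p ^ 2 - 8 * p + 4))) *
    Real.log ((n : ℝ) / ε ^ (p / (p - 2)))

end IRLS

end

/-!
For `p > 2` let `q = p / (p - 2)` be the exponent dual to `p / 2`, and `E(r)` the minimum of
`∑ i, rᵢ yᵢ²` over `A y = b`, attained at `x(r)`. By Hölder, `E(r) ≤ ‖r‖_q ‖y‖_p²` for every feasible
`y` (`sum_mul_sq_le`), so a vector `r` with large `E(r) / ‖r‖_q` bounds the optimum from below.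

*Dual progress.* An update `rᵢ ↦ rᵢ αᵢ` raises the energy by at least
`∑ i, rᵢ xᵢ² (1 - 1 / αᵢ)` (`energy_le`, by evaluating the concave dual of the least squares problem at
the old optimum). The choice `αᵢ = γᵢ^{1/q}` makes this at least `M²` times the growth of `‖r‖_q`
(`mul_lpNorm_update_sub_le`). As `‖r‖_q` starts from `1`, a final `‖r‖_q > 1 / ε` gives
`E(r) ≥ (1 - ε) M² ‖r‖_q`.

*Primal progress.* In a round where all `αᵢ` are at most the threshold `T = smallStep n p ε`, the
coordinates of `x` with `γᵢ = 1` have `p`-norm at most `√(1 + δ) M`, and any other coordinate is at most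
`M (4 / δ + √T) (rᵢ αᵢ)^{(q-1)/2} log γᵢ` (`abs_le_of_one_add_le_gam`). Since `r` only grows and
`∑ log γᵢ` telescopes to `log (n rᵢ^q)`, the second contributions to the sum `s` have total `p`-norm at
most `M (4 / δ + √T) ‖r‖_q^{(q-1)/2} log (n / ε^q)`, which is negligible against `m δ M` after
sufficiently many small updates (`SubInv.small_count_le`).

*Large updates.* An update with some `αᵢ > T` raises `‖r‖_q^q ≤ ε^{-q}` by at least `(T^q - 1) / n`,
as `rᵢ^q ≥ 1 / n` (`SubInv.large_count_le`). The value of `T` balances this count with the one for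
small updates. Only for `n = 1` and `q` close to `1` can `T^q` be close to `1`; then `γᵢ ≥ 1 + δ` is
used instead (`of_smallStep_rpow_lt`).

The structure `SubInv` collects these facts as an invariant of the loop, and `SubInv.step` is the
induction step. In the binary search the certificates lose a factor `(1 + δ)² / √(1 - ε)` in total,
which is at most `1 + ε` for `δ = ε / 32`. The first interval of guesses has
`O(1 + log n / ε)` elements.
-/

namespace IRLS

/-! ### The `ℓ_s` norm -/

section Norm

variable {n : ℕ} {s : ℝ}

lemma lpNorm_eq (hs : 0 < s) (v : Fin n → ℝ) :
    lpNorm s v = (∑ i, |v i| ^ s) ^ (1 / s) := by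
  have h : (ENNReal.ofReal s).toReal = s := ENNReal.toReal_ofReal hs.le
  rw [lpNorm, PiLp.norm_eq_sum (by rw [h]; exact hs), h]
  simp [Real.norm_eq_abs]

lemma lpNorm_nonneg (hs : 0 < s) (v : Fin n → ℝ) : 0 ≤ lpNorm s v := by
  rw [lpNorm_eq hs]; positivity

lemma lpNorm_rpow (hs : 0 < s) (v : Fin n → ℝ) : lpNorm s v ^ s = ∑ i, |v i| ^ s := by
  rw [lpNorm_eq hs, ← Real.rpow_mul (by positivity), one_div_mul_cancel hs.ne', Real.rpow_one]

lemma lpNorm_le_of_sum_le (hs : 0 < s) {v : Fin n → ℝ} {B : ℝ} (hB : 0 ≤ B)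
    (h : ∑ i, |v i| ^ s ≤ B ^ s) : lpNorm s v ≤ B := by
  rw [← lpNorm_rpow hs] at h
  exact (Real.rpow_le_rpow_iff (lpNorm_nonneg hs v) hB hs).1 h

lemma lpNorm_mono (hs : 0 < s) {v w : Fin n → ℝ} (h : ∀ i, |v i| ≤ |w i|) :
    lpNorm s v ≤ lpNorm s w := by
  refine lpNorm_le_of_sum_le hs (lpNorm_nonneg hs w) ?_
  rw [lpNorm_rpow hs]
  exact Finset.sum_le_sum fun i _ => Real.rpow_le_rpow (abs_nonneg _) (h i) hs.le

lemma lpNorm_add_le (hs : 1 ≤ s) (v w : Fin n → ℝ) :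
    lpNorm s (v + w) ≤ lpNorm s v + lpNorm s w := by
  have : Fact (1 ≤ ENNReal.ofReal s) := ⟨by simpa using hs⟩
  exact norm_add_le (WithLp.toLp (ENNReal.ofReal s) v) (WithLp.toLp (ENNReal.ofReal s) w)

lemma lpNorm_const_mul (hs : 1 ≤ s) (a : ℝ) (v : Fin n → ℝ) :
    lpNorm s (fun i => a * v i) = |a| * lpNorm s v := by
  have : Fact (1 ≤ ENNReal.ofReal s) := ⟨by simpa using hs⟩
  have h := norm_smul a (WithLp.toLp (ENNReal.ofReal s) v)
  rwa [← WithLp.toLp_smul, Real.norm_eq_abs] at h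

lemma lpNorm_zero (hs : 0 < s) : lpNorm s (0 : Fin n → ℝ) = 0 := by
  rw [lpNorm_eq hs]
  simp [Real.zero_rpow hs.ne', hs.ne']

lemma lpNorm_two_sq (v : Fin n → ℝ) : lpNorm 2 v ^ 2 = ∑ i, v i ^ 2 := by
  have := lpNorm_rpow two_pos v
  simpa using this

lemma lpNorm_pos (hs : 0 < s) {v : Fin n → ℝ} (hv : v ≠ 0) : 0 < lpNorm s v := by
  obtain ⟨i, hi⟩ := Function.ne_iff.1 hv
  rw [lpNorm_eq hs]
  refine Real.rpow_pos_of_pos (Finset.sum_pos' (fun j _ => by positivity) ⟨i, Finset.mem_univ i, ?_⟩) _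
  exact Real.rpow_pos_of_pos (abs_pos.2 hi) _

lemma abs_le_lpNorm (hs : 0 < s) (v : Fin n → ℝ) (i : Fin n) : |v i| ≤ lpNorm s v := by
  refine (Real.rpow_le_rpow_iff (abs_nonneg _) (lpNorm_nonneg hs v) hs).1 ?_
  rw [lpNorm_rpow hs]
  exact Finset.single_le_sum (f := fun i => |v i| ^ s) (fun j _ => by positivity) (Finset.mem_univ i)

lemma lpNorm_le_lpNorm_two {p : ℝ} (hp : 2 ≤ p) (v : Fin n → ℝ) : lpNorm p v ≤ lpNorm 2 v := by
  have hN := lpNorm_nonneg two_pos v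
  refine lpNorm_le_of_sum_le (by linarith) hN ?_
  have h (i : Fin n) : |v i| ^ p ≤ lpNorm 2 v ^ (p - 2) * v i ^ 2 := by
    rcases eq_or_ne (v i) 0 with h0 | h0
    · simp [h0, Real.zero_rpow (by linarith : p ≠ 0)]
    · calc |v i| ^ p = |v i| ^ (p - 2) * |v i| ^ (2 : ℝ) := by
            rw [← Real.rpow_add (abs_pos.2 h0)]; ring_nf
        _ ≤ lpNorm 2 v ^ (p - 2) * |v i| ^ (2 : ℝ) := by
            gcongr
            exact abs_le_lpNorm two_pos v i
        _ = _ := by simp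
  calc ∑ i, |v i| ^ p ≤ ∑ i, lpNorm 2 v ^ (p - 2) * v i ^ 2 := Finset.sum_le_sum fun i _ => h i
    _ = lpNorm 2 v ^ (p - 2) * lpNorm 2 v ^ (2 : ℝ) := by
        rw [← Finset.mul_sum, ← lpNorm_two_sq]; simp
    _ = lpNorm 2 v ^ p := by
        rw [← Real.rpow_add' hN (by linarith)]; ring_nf

/-- Hölder's inequality for the pair `p / 2`, `q`, where `q` is the dual exponent. -/
lemma sum_mul_sq_le {p : ℝ} (hp : 2 < p) (r y : Fin n → ℝ) :
    ∑ i, r i * y i ^ 2 ≤ lpNorm (dualExp p) r * lpNorm p y ^ 2 := by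
  have hq : 0 < dualExp p := div_pos (by linarith) (by linarith)
  have hpq : (dualExp p).HolderConjugate (p / 2) := by
    rw [Real.holderConjugate_iff, dualExp]
    refine ⟨?_, ?_⟩
    · rw [lt_div_iff₀ (by linarith)]; linarith
    · field_simp; ring
  refine (Real.inner_le_Lp_mul_Lq Finset.univ r (fun i => y i ^ 2) hpq).trans_eq ?_
  rw [lpNorm_eq hq, lpNorm_eq (by linarith : 0 < p), ← Real.rpow_natCast, ← Real.rpow_mul (by positivity)]
  have h (i : Fin n) : |y i ^ 2| ^ (p / 2) = |y i| ^ p := by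
    rw [abs_pow, ← Real.rpow_natCast, ← Real.rpow_mul (abs_nonneg _)]
    congr 1; push_cast; ring
  simp only [h]
  congr 2
  push_cast; field_simp

lemma lpNorm_two_le {p : ℝ} (hp : 2 < p) (hn : 0 < n) (y : Fin n → ℝ) :
    lpNorm 2 y / (n : ℝ) ^ (1 / 2 - 1 / p) ≤ lpNorm p y := by
  have hq : 0 < dualExp p := div_pos (by linarith) (by linarith)
  have h := sum_mul_sq_le hp (fun _ : Fin n => 1) y
  have h1 : lpNorm (dualExp p) (fun _ : Fin n => (1 : ℝ)) = ((n : ℝ) ^ (1 / 2 - 1 / p)) ^ 2 := by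
    rw [lpNorm_eq hq, ← Real.rpow_natCast, ← Real.rpow_mul (by positivity)]
    simp only [abs_one, Real.one_rpow, Finset.sum_const, Finset.card_univ, Fintype.card_fin,
      nsmul_eq_mul, mul_one]
    congr 1
    rw [dualExp]; push_cast; field_simp
  rw [h1, ← mul_pow] at h
  simp only [one_mul] at h
  rw [← lpNorm_two_sq] at h
  rw [div_le_iff₀ (by positivity), mul_comm]
  exact (pow_le_pow_iff_left₀ (lpNorm_nonneg two_pos y)
    (mul_nonneg (by positivity) (lpNorm_nonneg (by linarith) y)) two_ne_zero).1 h

end Norm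

/-! ### Weighted least squares -/

section LeastSquares

variable {d n : ℕ} {A : Matrix (Fin d) (Fin n) ℝ} {b : Fin d → ℝ}
  {solve : (Fin n → ℝ) → (Fin d → ℝ)}

/-- The normal equations are solvable: `A D Aᵀ = B Bᵀ` with `B = A D^{1/2}`, and `B Bᵀ` has the
same range as `B`. -/
lemma exists_normal_solution (hb : ∃ y : Fin n → ℝ, A *ᵥ y = b) {D : Fin n → ℝ}
    (hD : ∀ i, 0 < D i) : ∃ φ : Fin d → ℝ, (A * Matrix.diagonal D * Aᵀ) *ᵥ φ = b := by
  obtain ⟨y, rfl⟩ := hb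
  set B := A * Matrix.diagonal (fun i => √(D i)) with hB
  have hBB : A * Matrix.diagonal D * Aᵀ = B * Bᵀ := by
    rw [hB, transpose_mul, diagonal_transpose, Matrix.mul_assoc A, Matrix.mul_assoc A,
      ← Matrix.mul_assoc (diagonal _) (diagonal _), diagonal_mul_diagonal]
    simp only [Real.mul_self_sqrt (hD _).le]
  have hle : LinearMap.range (B * Bᵀ).mulVecLin ≤ LinearMap.range B.mulVecLin := by
    rw [mulVecLin_mul]; exact LinearMap.range_comp_le_range _ _
  have heq := Submodule.eq_of_le_of_finrank_eq hle (rank_self_mul_transpose B)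
  have hmem : A *ᵥ y ∈ LinearMap.range B.mulVecLin := by
    refine ⟨fun i => y i / √(D i), ?_⟩
    rw [mulVecLin_apply, hB, ← mulVec_mulVec]
    congr 1
    ext i
    rw [mulVec_diagonal, mul_div_cancel₀ _ (Real.sqrt_pos.2 (hD i)).ne']
  rw [← heq] at hmem
  obtain ⟨φ, hφ⟩ := hmem
  exact ⟨φ, by rw [hBB]; exact hφ⟩

lemma wls_feasible (hs : IsSolver A b solve) (hb : ∃ y : Fin n → ℝ, A *ᵥ y = b)
    {r : Fin n → ℝ} (hr : ∀ i, 0 < r i) : A *ᵥ wls A solve r = b := by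
  have hD : ∀ i, 0 < 1 / r i := fun i => one_div_pos.2 (hr i)
  have h := hs (fun i => 1 / r i) (fun i => (hD i).le) (exists_normal_solution hb hD)
  rw [← mulVec_mulVec, ← mulVec_mulVec] at h
  have hx : wls A solve r = diagonal (fun i => 1 / r i) *ᵥ Aᵀ *ᵥ solve fun i => 1 / r i := by
    ext i
    rw [mulVec_diagonal, wls]
  rw [hx, h]

/-- `r · x(r) = Aᵀ φ` is orthogonal to the kernel of `A`. -/
lemma sum_mul_wls_mul (hs : IsSolver A b solve) (hb : ∃ y : Fin n → ℝ, A *ᵥ y = b)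
    {r : Fin n → ℝ} (hr : ∀ i, 0 < r i) {y : Fin n → ℝ} (hy : A *ᵥ y = b) :
    ∑ i, r i * wls A solve r i * y i = ∑ i, r i * wls A solve r i ^ 2 := by
  set φ := solve (fun i => 1 / r i) with hφ
  have h (z : Fin n → ℝ) : ∑ i, r i * wls A solve r i * z i = φ ⬝ᵥ (A *ᵥ z) := by
    rw [dotProduct_mulVec, ← mulVec_transpose, dotProduct]
    refine Finset.sum_congr rfl fun i _ => ?_
    have := (hr i).ne'
    simp only [wls, ← hφ]
    field_simp
  simp only [pow_two, ← mul_assoc]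
  rw [h, h, hy, wls_feasible hs hb hr]

/-- After the weights change from `r` to `r'`, the minimum of `⟨r', y²⟩` is at least the value at
the old minimizer `x` of the concave dual objective, `2 ⟨r, x²⟩ - ∑ i, rᵢ² xᵢ² / r'ᵢ`. -/
lemma energy_le (hs : IsSolver A b solve) (hb : ∃ y : Fin n → ℝ, A *ᵥ y = b)
    {r α : Fin n → ℝ} (hr : ∀ i, 0 < r i) (hα : ∀ i, 0 < α i) {y : Fin n → ℝ} (hy : A *ᵥ y = b) :
    ∑ i, r i * wls A solve r i ^ 2 + ∑ i, r i * wls A solve r i ^ 2 * (1 - 1 / α i) ≤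
      ∑ i, r i * α i * y i ^ 2 := by
  set x := wls A solve r with hx
  have h : ∑ i, (2 * (r i * x i * y i) - r i * x i ^ 2 / α i) ≤ ∑ i, r i * α i * y i ^ 2 := by
    refine Finset.sum_le_sum fun i _ => ?_
    have h0 : 0 ≤ r i / α i * (α i * y i - x i) ^ 2 := by
      have := hr i; have := hα i; positivity
    have h1 : r i / α i * (α i * y i - x i) ^ 2 =
        r i * α i * y i ^ 2 - (2 * (r i * x i * y i) - r i * x i ^ 2 / α i) := by
      have := (hα i).ne'; field_simp; ring
    linarith
  refine le_trans (le_of_eq ?_) h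
  rw [Finset.sum_sub_distrib, ← Finset.mul_sum, hx, sum_mul_wls_mul hs hb hr hy, ← hx]
  simp only [mul_sub, mul_one, Finset.sum_sub_distrib, mul_one_div]
  ring

lemma lpNorm_two_wls_le (hs : IsSolver A b solve) (hb : ∃ y : Fin n → ℝ, A *ᵥ y = b)
    {y : Fin n → ℝ} (hy : A *ᵥ y = b) :
    lpNorm 2 (wls A solve fun _ => 1) ≤ lpNorm 2 y := by
  have h := energy_le hs hb (r := fun _ => 1) (α := fun _ => 1) (fun _ => one_pos)
    (fun _ => one_pos) hy
  simp only [one_mul, div_one, sub_self, mul_zero, Finset.sum_const_zero, add_zero] at h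
  rw [← lpNorm_two_sq, ← lpNorm_two_sq] at h
  exact (pow_le_pow_iff_left₀ (lpNorm_nonneg two_pos _) (lpNorm_nonneg two_pos _) two_ne_zero).1 h

end LeastSquares

/-! ### One multiplicative update -/

section Update

variable {d n : ℕ} {A : Matrix (Fin d) (Fin n) ℝ} {b : Fin d → ℝ}
  {solve : (Fin n → ℝ) → (Fin d → ℝ)} {p δ M : ℝ} {r x : Fin n → ℝ}

lemma one_lt_dualExp (hp : 2 < p) : 1 < dualExp p := by
  rw [dualExp, lt_div_iff₀ (by linarith)]; linarith

lemma dualExp_sub_one_mul (hp : 2 < p) : (dualExp p - 1) / 2 * p = dualExp p := by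
  have : p - 2 ≠ 0 := by linarith
  rw [dualExp]; field_simp; ring

lemma gam_eq_one_or (hM : 0 < M) (i : Fin n) :
    (gam p δ M r x i = 1 ∧ congestion p r x i < (1 + δ) * M ^ 2) ∨
      (1 + δ ≤ gam p δ M r x i ∧ congestion p r x i = gam p δ M r x i * M ^ 2) := by
  unfold gam
  split_ifs with h
  · right
    refine ⟨?_, ?_⟩
    · rwa [le_div_iff₀ (by positivity)]
    · field_simp
  · exact Or.inl ⟨rfl, not_le.1 h⟩

lemma one_le_gam (hM : 0 < M) (hδ : 0 ≤ δ) (i : Fin n) : 1 ≤ gam p δ M r x i := by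
  rcases gam_eq_one_or (p := p) (δ := δ) (r := r) (x := x) hM i with h | h
  · exact h.1.ge
  · linarith [h.1]

lemma one_le_alph (hp : 2 < p) (hM : 0 < M) (hδ : 0 ≤ δ) (i : Fin n) :
    1 ≤ alph p δ M r x i :=
  Real.one_le_rpow (one_le_gam hM hδ i) (by have := one_lt_dualExp hp; positivity)

lemma alph_rpow (hp : 2 < p) (hM : 0 < M) (hδ : 0 ≤ δ) (i : Fin n) :
    alph p δ M r x i ^ dualExp p = gam p δ M r x i := by
  have := one_lt_dualExp hp
  rw [alph, ← Real.rpow_mul (by linarith [one_le_gam (p := p) (r := r) (x := x) hM hδ i]),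
    one_div_mul_cancel (by linarith), Real.rpow_one]

lemma update_rpow (hp : 2 < p) (hM : 0 < M) (hδ : 0 ≤ δ) (hr : ∀ i, 0 < r i) (i : Fin n) :
    (r i * alph p δ M r x i) ^ dualExp p = r i ^ dualExp p * gam p δ M r x i := by
  rw [Real.mul_rpow (hr i).le (by linarith [one_le_alph (r := r) (x := x) hp hM hδ i]),
    alph_rpow hp hM hδ]

lemma lpNorm_rpow_of_pos (hp : 2 < p) (hr : ∀ i, 0 < r i) :
    lpNorm (dualExp p) r ^ dualExp p = ∑ i, r i ^ dualExp p := by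
  rw [lpNorm_rpow (by linarith [one_lt_dualExp hp])]
  simp only [abs_of_pos (hr _)]

lemma lpNorm_update_rpow (hp : 2 < p) (hM : 0 < M) (hδ : 0 ≤ δ) (hr : ∀ i, 0 < r i) :
    lpNorm (dualExp p) (fun i => r i * alph p δ M r x i) ^ dualExp p =
      lpNorm (dualExp p) r ^ dualExp p + ∑ i, r i ^ dualExp p * (gam p δ M r x i - 1) := by
  rw [lpNorm_rpow_of_pos hp, lpNorm_rpow_of_pos hp hr, ← Finset.sum_add_distrib]
  · exact Finset.sum_congr rfl fun i _ => by rw [update_rpow hp hM hδ hr]; ring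
  · exact fun i => mul_pos (hr i) (by linarith [one_le_alph (r := r) (x := x) hp hM hδ i])

/-- Concavity of `t ↦ t ^ (1 / q)` bounds the growth of the dual norm in one update. -/
lemma lpNorm_update_sub_le (hp : 2 < p) (hM : 0 < M) (hδ : 0 ≤ δ) (hr : ∀ i, 0 < r i)
    (hN : 0 < lpNorm (dualExp p) r) :
    lpNorm (dualExp p) (fun i => r i * alph p δ M r x i) - lpNorm (dualExp p) r ≤
      ∑ i, r i ^ dualExp p / lpNorm (dualExp p) r ^ (dualExp p - 1) *
        ((gam p δ M r x i - 1) / dualExp p) := by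
  have hq := one_lt_dualExp hp
  have hup := lpNorm_update_rpow (x := x) hp hM hδ hr
  set q := dualExp p
  set N := lpNorm q r
  set N' := lpNorm q (fun i => r i * alph p δ M r x i) with hN'
  set S := ∑ i, r i ^ q * (gam p δ M r x i - 1) with hS
  have hS0 : 0 ≤ S := Finset.sum_nonneg fun i _ => mul_nonneg (by have := hr i; positivity)
    (by linarith [one_le_gam (p := p) (r := r) (x := x) hM hδ i])
  have hNq : 0 < N ^ q := by positivity
  have h1 : N' ^ q = N ^ q * (1 + S / N ^ q) := by rw [hup]; field_simp
  have h2 : N' = N * (1 + S / N ^ q) ^ (1 / q) := by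
    have h0 : 0 ≤ N' := lpNorm_nonneg (by linarith) _
    have h3 : N' = (N' ^ q) ^ (1 / q) := by
      rw [← Real.rpow_mul h0, mul_one_div_cancel (by linarith), Real.rpow_one]
    rw [h3, h1, Real.mul_rpow hNq.le (by positivity), ← Real.rpow_mul hN.le,
      mul_one_div_cancel (by linarith), Real.rpow_one]
  have h3 : (1 + S / N ^ q) ^ (1 / q) ≤ 1 + 1 / q * (S / N ^ q) :=
    rpow_one_add_le_one_add_mul_self (by linarith [show 0 ≤ S / N ^ q by positivity])
      (by positivity) (by rw [div_le_one] <;> linarith)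
  have h4 : N ^ q = N ^ (q - 1) * N := by
    rw [Real.rpow_sub_one hN.ne']; field_simp
  have h5 : ∑ i, r i ^ q / N ^ (q - 1) * ((gam p δ M r x i - 1) / q) = S / N ^ (q - 1) / q := by
    rw [hS, Finset.sum_div, Finset.sum_div]
    exact Finset.sum_congr rfl fun i _ => by field_simp
  rw [h5, h2]
  calc N * (1 + S / N ^ q) ^ (1 / q) - N ≤ N * (1 + 1 / q * (S / N ^ q)) - N := by gcongr
    _ = S / N ^ (q - 1) / q := by rw [h4]; field_simp; ring

lemma sq_eq_of_congestion (hN : 0 < lpNorm (dualExp p) r) (hr : ∀ i, 0 < r i) (i : Fin n) :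
    x i ^ 2 = congestion p r x i * (r i / lpNorm (dualExp p) r) ^ (dualExp p - 1) := by
  have := hr i
  rw [congestion, Real.div_rpow this.le hN.le]
  field_simp

/-- The heart of the method: one update raises the energy by at least `M²` times the growth of
`‖r‖_q`. Coordinate by coordinate this is Bernoulli's inequality
`γ ^ (1 - 1/q) ≤ 1 + (1 - 1/q) (γ - 1)`. -/
lemma mul_lpNorm_update_sub_le (hp : 2 < p) (hM : 0 < M) (hδ : 0 ≤ δ) (hr : ∀ i, 0 < r i)
    (hN : 0 < lpNorm (dualExp p) r) :
    M ^ 2 * (lpNorm (dualExp p) (fun i => r i * alph p δ M r x i) - lpNorm (dualExp p) r) ≤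
      ∑ i, r i * x i ^ 2 * (1 - 1 / alph p δ M r x i) := by
  have hq := one_lt_dualExp hp
  refine (mul_le_mul_of_nonneg_left (lpNorm_update_sub_le (x := x) hp hM hδ hr hN)
    (sq_nonneg M)).trans ?_
  rw [Finset.mul_sum]
  refine Finset.sum_le_sum fun i _ => ?_
  have hri := hr i
  have hsq := sq_eq_of_congestion (x := x) hN hr i
  have hγ1 := one_le_gam (p := p) (r := r) (x := x) hM hδ i
  have hα : alph p δ M r x i = gam p δ M r x i ^ (1 / dualExp p) := rfl
  rcases gam_eq_one_or (p := p) (δ := δ) (r := r) (x := x) hM i with h | h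
  · rw [hα, h.1]; simp
  rw [hsq, h.2, hα]
  set q := dualExp p
  set N := lpNorm q r
  set γ := gam p δ M r x i
  have hγ : 0 < γ := by linarith
  have h1 : γ * (1 - 1 / γ ^ (1 / q)) = γ - γ ^ (1 - 1 / q) := by
    rw [Real.rpow_sub hγ, Real.rpow_one]; ring
  have h2 : γ ^ (1 - 1 / q) ≤ 1 + (1 - 1 / q) * (γ - 1) := by
    have hq1 : 1 / q ≤ 1 := by rw [div_le_one] <;> linarith
    have hq0 : 0 < 1 / q := by positivity
    have := rpow_one_add_le_one_add_mul_self (s := γ - 1) (p := 1 - 1 / q) (by linarith)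
      (by linarith) (by linarith)
    simpa using this
  have h3 : r i ^ q = r i ^ (q - 1) * r i := by
    rw [Real.rpow_sub_one hri.ne']; field_simp
  have h4 : r i * (γ * M ^ 2 * (r i / N) ^ (q - 1)) * (1 - 1 / γ ^ (1 / q)) =
      M ^ 2 * (r i ^ q / N ^ (q - 1)) * (γ - γ ^ (1 - 1 / q)) := by
    rw [← h1, Real.div_rpow hri.le hN.le, h3]; ring
  rw [h4, ← mul_assoc]
  gcongr
  have : (γ - 1) / q = γ - (1 + (1 - 1 / q) * (γ - 1)) := by field_simp; ring
  rw [this]; linarith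

lemma abs_le_of_congestion_le (hN : 0 < lpNorm (dualExp p) r) (hr : ∀ i, 0 < r i) {B : ℝ}
    {i : Fin n} (hx : congestion p r x i ≤ B) :
    |x i| ≤ √B * (r i / lpNorm (dualExp p) r) ^ ((dualExp p - 1) / 2) := by
  have hri := hr i
  have h0 : 0 ≤ r i / lpNorm (dualExp p) r := by positivity
  have h1 : x i ^ 2 ≤ B * (r i / lpNorm (dualExp p) r) ^ (dualExp p - 1) := by
    rw [sq_eq_of_congestion hN hr]; gcongr
  have h2 : √((r i / lpNorm (dualExp p) r) ^ (dualExp p - 1)) =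
      (r i / lpNorm (dualExp p) r) ^ ((dualExp p - 1) / 2) := by
    rw [Real.sqrt_eq_rpow, ← Real.rpow_mul h0]; congr 1; ring
  rw [← h2, ← Real.sqrt_mul' _ (by positivity)]
  exact Real.abs_le_sqrt h1

lemma abs_le_of_gam_eq_one (hM : 0 < M) (hδ : 0 ≤ δ) (hN : 0 < lpNorm (dualExp p) r)
    (hr : ∀ i, 0 < r i) {i : Fin n} (h : gam p δ M r x i = 1) :
    |x i| ≤ √(1 + δ) * M * (r i / lpNorm (dualExp p) r) ^ ((dualExp p - 1) / 2) := by
  have hc : congestion p r x i ≤ (1 + δ) * M ^ 2 := by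
    rcases gam_eq_one_or (p := p) (δ := δ) (r := r) (x := x) hM i with h' | h'
    · exact h'.2.le
    · rw [h'.2, h]; nlinarith [sq_nonneg M]
  have := abs_le_of_congestion_le hN hr hc
  rwa [Real.sqrt_mul (by linarith), Real.sqrt_sq hM.le] at this

lemma lpNorm_rpow_half (hp : 2 < p) (hr : ∀ i, 0 ≤ r i) :
    lpNorm p (fun i => r i ^ ((dualExp p - 1) / 2)) =
      lpNorm (dualExp p) r ^ ((dualExp p - 1) / 2) := by
  have hq := one_lt_dualExp hp
  have h (i : Fin n) : |r i ^ ((dualExp p - 1) / 2)| ^ p = |r i| ^ dualExp p := by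
    rw [abs_of_nonneg (Real.rpow_nonneg (hr i) _), ← Real.rpow_mul (hr i),
      dualExp_sub_one_mul hp, abs_of_nonneg (hr i)]
  rw [lpNorm_eq (by linarith)]
  simp only [h]
  rw [← lpNorm_rpow (by linarith), ← Real.rpow_mul (lpNorm_nonneg (by linarith) _)]
  congr 1
  have := dualExp_sub_one_mul hp
  have hp0 : p ≠ 0 := by linarith
  field_simp; linarith

lemma lpNorm_const_mul_normalized (hp : 2 < p) (hr : ∀ i, 0 < r i)
    (hN : 0 < lpNorm (dualExp p) r) {B : ℝ} (hB : 0 ≤ B) :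
    lpNorm p (fun i => B * (r i / lpNorm (dualExp p) r) ^ ((dualExp p - 1) / 2)) = B := by
  rw [lpNorm_const_mul (by linarith), lpNorm_rpow_half hp (fun i => by have := hr i; positivity),
    abs_of_nonneg hB]
  have := lpNorm_const_mul (s := dualExp p) (one_lt_dualExp hp).le (lpNorm (dualExp p) r)⁻¹ r
  simp only [div_eq_inv_mul]
  rw [this, abs_of_pos (by positivity), inv_mul_cancel₀ hN.ne', Real.one_rpow, mul_one]

lemma lpNorm_le_of_forall_gam_eq_one (hp : 2 < p) (hM : 0 < M) (hδ : 0 ≤ δ) (hr : ∀ i, 0 < r i)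
    (hN : 0 < lpNorm (dualExp p) r) {z : Fin n → ℝ}
    (hz : ∀ i, z i = 0 ∨ z i = x i ∧ gam p δ M r x i = 1) : lpNorm p z ≤ √(1 + δ) * M := by
  rw [← lpNorm_const_mul_normalized hp hr hN (by positivity : 0 ≤ √(1 + δ) * M)]
  refine lpNorm_mono (by linarith) fun i => ?_
  have hri := hr i
  rw [abs_of_nonneg (a := _ * _) (by positivity)]
  rcases hz i with h | h
  · rw [h, abs_zero]; positivity
  · rw [h.1]; exact abs_le_of_gam_eq_one hM hδ hN hr h.2

lemma log_one_add_ge (hδ : 0 ≤ δ) (hδ1 : δ ≤ 1) : δ / 2 ≤ Real.log (1 + δ) := by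
  have h := Real.one_sub_inv_le_log_of_pos (x := 1 + δ) (by linarith)
  have : δ / 2 ≤ 1 - (1 + δ)⁻¹ := by
    rw [show 1 - (1 + δ)⁻¹ = δ / (1 + δ) by field_simp; ring]
    gcongr; linarith
  linarith

/-- The price of an overloaded coordinate in a small update, in terms of `log γ`: for bounded `γ`
use `log γ ≥ log (1 + δ) ≥ δ / 2`, and otherwise `log γ ≥ 1` and `α ≤ T`. -/
lemma sqrt_alph_le (hp : 2 < p) (hδ : 0 < δ) (hδ1 : δ ≤ 1) {T : ℝ} {i : Fin n}
    (hg : 1 + δ ≤ gam p δ M r x i) (hT : alph p δ M r x i ≤ T) :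
    √(alph p δ M r x i) ≤ (4 / δ + √T) * Real.log (gam p δ M r x i) := by
  have hq := one_lt_dualExp hp
  have hα : alph p δ M r x i ≤ gam p δ M r x i := by
    have h1 : gam p δ M r x i ^ (1 / dualExp p) ≤ gam p δ M r x i ^ (1 : ℝ) :=
      Real.rpow_le_rpow_of_exponent_le (by linarith) (by rw [div_le_one] <;> linarith)
    rwa [Real.rpow_one] at h1
  have hl : δ / 2 ≤ Real.log (gam p δ M r x i) :=
    (log_one_add_ge hδ.le hδ1).trans (Real.log_le_log (by linarith) hg)
  set γ := gam p δ M r x i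
  rcases le_total γ 4 with h | h
  · have h2 : √(alph p δ M r x i) ≤ 2 := by
      rw [Real.sqrt_le_left (by norm_num)]; linarith
    calc √(alph p δ M r x i) ≤ 4 / δ * (δ / 2) := by
          rw [show 4 / δ * (δ / 2) = 2 by field_simp; norm_num]; exact h2
      _ ≤ (4 / δ + √T) * Real.log γ := by
          gcongr
          linarith [Real.sqrt_nonneg T]
  · have h1 : 1 ≤ Real.log γ := by
      rw [Real.le_log_iff_exp_le (by linarith)]
      linarith [Real.exp_one_lt_d9]
    calc √(alph p δ M r x i) ≤ √T * 1 := by rw [mul_one]; exact Real.sqrt_le_sqrt hT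
      _ ≤ (4 / δ + √T) * Real.log γ := by
          gcongr
          linarith [show 0 ≤ 4 / δ by positivity]

lemma abs_le_of_one_add_le_gam (hp : 2 < p) (hM : 0 < M) (hδ : 0 < δ) (hδ1 : δ ≤ 1)
    (hr : ∀ i, 0 < r i) (hN : 1 ≤ lpNorm (dualExp p) r) {T : ℝ} {i : Fin n}
    (hg : 1 + δ ≤ gam p δ M r x i) (hT : alph p δ M r x i ≤ T) :
    |x i| ≤ M * (4 / δ + √T) *
      ((r i * alph p δ M r x i) ^ ((dualExp p - 1) / 2) * Real.log (gam p δ M r x i)) := by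
  have hri := hr i
  have hq := one_lt_dualExp hp
  have hα1 := one_le_alph (r := r) (x := x) hp hM hδ.le i
  have hγ : congestion p r x i ≤ gam p δ M r x i * M ^ 2 := by
    rcases gam_eq_one_or (p := p) (δ := δ) (r := r) (x := x) hM i with h | h
    · linarith [h.1]
    · exact h.2.le
  have h := abs_le_of_congestion_le (by linarith) hr hγ
  have hs := sqrt_alph_le hp hδ hδ1 hg hT
  have hsq : √(gam p δ M r x i) =
      √(alph p δ M r x i) * alph p δ M r x i ^ ((dualExp p - 1) / 2) := by
    rw [← alph_rpow hp hM hδ.le, Real.sqrt_eq_rpow, Real.sqrt_eq_rpow,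
      ← Real.rpow_mul (by linarith), ← Real.rpow_add (by linarith)]
    congr 1; ring
  rw [Real.sqrt_mul (by linarith), Real.sqrt_sq hM.le, hsq] at h
  refine h.trans ?_
  rw [Real.mul_rpow hri.le (by linarith)]
  have hr' : (r i / lpNorm (dualExp p) r) ^ ((dualExp p - 1) / 2) ≤
      r i ^ ((dualExp p - 1) / 2) :=
    Real.rpow_le_rpow (by positivity) (div_le_self hri.le hN) (by linarith)
  calc _ ≤ (4 / δ + √T) * Real.log (gam p δ M r x i) *
        alph p δ M r x i ^ ((dualExp p - 1) / 2) * M * r i ^ ((dualExp p - 1) / 2) := by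
        gcongr
        exact mul_nonneg (mul_nonneg ((Real.sqrt_nonneg _).trans hs)
          (Real.rpow_nonneg (by linarith) _)) hM.le
    _ = _ := by ring

end Update
/-! ### The loop of the subproblem solver -/

section Loop

variable {d n : ℕ} {A : Matrix (Fin d) (Fin n) ℝ} {b : Fin d → ℝ}
  {solve : (Fin n → ℝ) → (Fin d → ℝ)} {p ε δ M : ℝ}

/-- The loop variables after one more round. -/
noncomputable def SubState.next (A : Matrix (Fin d) (Fin n) ℝ) (solve : (Fin n → ℝ) → (Fin d → ℝ))
    (p ε δ M : ℝ) (st : SubState n) : SubState n :=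
  let x := wls A solve st.r
  let small : Prop := ∀ i, alph p δ M st.r x i ≤ smallStep n p ε
  ⟨fun i => st.r i * alph p δ M st.r x i, if small then st.s + x else st.s,
    if small then st.m + 1 else st.m⟩

lemma subLoop_succ (k : ℕ) (st : SubState n) :
    subLoop A solve p ε δ M (k + 1) st =
      if lpNorm (dualExp p) st.r ≤ 1 / ε then
        if ∀ i, gam p δ M st.r (wls A solve st.r) i = 1 then
          some (Outcome.primal (wls A solve st.r), 1)
        else if 0 < (st.next A solve p ε δ M).m ∧
            lpNorm p (fun i => (st.next A solve p ε δ M).s i / ((st.next A solve p ε δ M).m : ℝ)) ≤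
              (1 + δ) * M then
          some (Outcome.primal fun i =>
            (st.next A solve p ε δ M).s i / ((st.next A solve p ε δ M).m : ℝ), 1)
        else (subLoop A solve p ε δ M k (st.next A solve p ε δ M)).map fun o => (o.1, o.2 + 1)
      else some (Outcome.dual st.r, 0) := by
  simp only [subLoop, SubState.next]
  congr!

/-- The gain in `n ‖r‖_q^q` guaranteed by a large update: some `γᵢ` exceeds both `T^q`, where `T`
is the threshold for small updates, and `1 + δ`. -/
noncomputable def largeGain (n : ℕ) (p ε δ : ℝ) : ℝ := max (smallStep n p ε ^ dualExp p) (1 + δ) - 1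

/-- The invariant of the loop: `l` counts the large updates so far (`st.m` counts the small ones).
In `split`, the sum `s` of the primal vectors is divided into the contribution `u` of the
coordinates with `γᵢ = 1` and that of the others, which is charged to the growth of `log rᵢ`. -/
structure SubInv (A : Matrix (Fin d) (Fin n) ℝ) (b : Fin d → ℝ) (p ε δ M : ℝ) (l : ℕ)
    (st : SubState n) : Prop where
  r_pos : ∀ i, 0 < st.r i
  r_low : ∀ i, 1 ≤ n * st.r i ^ dualExp p
  norm_low : 1 + l * (largeGain n p ε δ / n) ≤ lpNorm (dualExp p) st.r ^ dualExp p
  energy : ∀ y, A *ᵥ y = b → M ^ 2 * (lpNorm (dualExp p) st.r - 1) ≤ ∑ i, st.r i * y i ^ 2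
  sum_feasible : A *ᵥ st.s = (st.m : ℝ) • b
  not_done : st.m = 0 ∨ (1 + δ) * M * st.m < lpNorm p st.s
  split : ∃ u v, st.s = u + v ∧ lpNorm p u ≤ st.m * (√(1 + δ) * M) ∧
    ∀ i, |v i| ≤ M * (4 / δ + √(smallStep n p ε)) *
      (st.r i ^ ((dualExp p - 1) / 2) * Real.log (n * st.r i ^ dualExp p))

lemma largeGain_pos (hδ : 0 < δ) : 0 < largeGain n p ε δ := by
  have := le_max_right (smallStep n p ε ^ dualExp p) (1 + δ)
  rw [largeGain]; linarith

lemma one_le_smallStep (hp : 2 < p) (hn : 0 < n) (hε : 0 < ε) (hε1 : ε ≤ 1) :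
    1 ≤ smallStep n p ε := by
  have hq := one_lt_dualExp hp
  have hn1 : (1 : ℝ) ≤ n := by exact_mod_cast hn
  have h1 := Real.one_le_rpow hn1 (z := 2 / (2 * dualExp p + 1)) (by positivity)
  have h2 := Real.one_le_rpow ((one_le_div hε).2 hε1)
    (z := (dualExp p - 1) / (2 * dualExp p + 1)) (div_nonneg (by linarith) (by linarith))
  exact one_le_mul_of_one_le_of_one_le h1 h2

lemma SubInv.one_le_lpNorm (hp : 2 < p) (hδ : 0 < δ) {l : ℕ} {st : SubState n}
    (h : SubInv A b p ε δ M l st) : 1 ≤ lpNorm (dualExp p) st.r := by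
  have hq := one_lt_dualExp hp
  have h1 := h.norm_low
  have : 0 ≤ l * (largeGain n p ε δ / n) := by
    have := largeGain_pos (n := n) (p := p) (ε := ε) hδ
    positivity
  refine (Real.rpow_le_rpow_iff zero_le_one (lpNorm_nonneg (by linarith) _)
    (by linarith : 0 < dualExp p)).1 ?_
  rw [Real.one_rpow]; linarith

lemma SubInv.initial (hp : 2 < p) (hn : 0 < n) :
    SubInv A b p ε δ M 0 ⟨fun _ => 1 / (n : ℝ) ^ (1 / dualExp p), 0, 0⟩ := by
  have hq := one_lt_dualExp hp
  have hn' : (0 : ℝ) < n := by exact_mod_cast hn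
  have hpos : 0 < 1 / (n : ℝ) ^ (1 / dualExp p) := by positivity
  have hpow : (1 / (n : ℝ) ^ (1 / dualExp p)) ^ dualExp p = 1 / n := by
    rw [Real.div_rpow zero_le_one (by positivity), Real.one_rpow, ← Real.rpow_mul hn'.le,
      one_div_mul_cancel (by linarith), Real.rpow_one]
  have hnorm : lpNorm (dualExp p) (fun _ : Fin n => 1 / (n : ℝ) ^ (1 / dualExp p)) = 1 := by
    rw [lpNorm_eq (by linarith)]
    simp only [abs_of_pos hpos, hpow]
    simp [hn'.ne']
  refine ⟨fun _ => hpos, fun _ => ?_, ?_, fun y _ => ?_, by simp, Or.inl rfl, 0, 0, by simp, ?_,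
    fun i => ?_⟩
  · simp only [hpow]; field_simp; rfl
  · simp only [hnorm]; simp
  · rw [hnorm, sub_self, mul_zero]; positivity
  · simp [lpNorm_zero (by linarith : 0 < p)]
  · simp only [hpow]; rw [mul_one_div_cancel hn'.ne']; simp

/-- Every round that does not return preserves the invariant and counts as a small or as a large
update. -/
lemma SubInv.step (hs : IsSolver A b solve) (hb : ∃ y : Fin n → ℝ, A *ᵥ y = b)
    (hp : 2 < p) (hε : 0 < ε) (hε1 : ε ≤ 1) (hδ : 0 < δ) (hδ1 : δ ≤ 1) (hM : 0 < M)
    {l : ℕ} {st : SubState n} (h : SubInv A b p ε δ M l st)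
    (hdone : ¬ (0 < (st.next A solve p ε δ M).m ∧
      lpNorm p (fun i => (st.next A solve p ε δ M).s i / ((st.next A solve p ε δ M).m : ℝ)) ≤
        (1 + δ) * M)) :
    ∃ l', (st.next A solve p ε δ M).m + l' = st.m + l + 1 ∧
      SubInv A b p ε δ M l' (st.next A solve p ε δ M) := by
  have hq := one_lt_dualExp hp
  have hN1 := h.one_le_lpNorm hp hδ
  have hN : 0 < lpNorm (dualExp p) st.r := by linarith
  set x := wls A solve st.r with hx
  set α := alph p δ M st.r x with hα
  set r' : Fin n → ℝ := fun i => st.r i * α i with hr'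
  have hα1 (i : Fin n) : 1 ≤ α i := one_le_alph hp hM hδ.le i
  have hle (i : Fin n) : st.r i ≤ r' i := le_mul_of_one_le_right (h.r_pos i).le (hα1 i)
  have hpos (i : Fin n) : 0 < r' i := (h.r_pos i).trans_le (hle i)
  have hpow (i : Fin n) : r' i ^ dualExp p = st.r i ^ dualExp p * gam p δ M st.r x i :=
    update_rpow hp hM hδ.le h.r_pos i
  have hγ1 (i : Fin n) : 1 ≤ gam p δ M st.r x i := one_le_gam hM hδ.le i
  have hlow (i : Fin n) : 1 ≤ n * r' i ^ dualExp p := by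
    refine (h.r_low i).trans ?_
    have := Real.rpow_le_rpow (h.r_pos i).le (hle i) (by linarith : 0 ≤ dualExp p)
    gcongr
  have hnorm := lpNorm_update_rpow (x := x) hp hM hδ.le h.r_pos
  have hterm (i : Fin n) : 0 ≤ st.r i ^ dualExp p * (gam p δ M st.r x i - 1) :=
    mul_nonneg (Real.rpow_nonneg (h.r_pos i).le _) (by linarith [hγ1 i])
  have henergy (y : Fin n → ℝ) (hy : A *ᵥ y = b) :
      M ^ 2 * (lpNorm (dualExp p) r' - 1) ≤ ∑ i, r' i * y i ^ 2 := by
    have h1 := energy_le hs hb h.r_pos (fun i => by linarith [hα1 i]) hy (α := α)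
    have h2 := mul_lpNorm_update_sub_le (x := x) hp hM hδ.le h.r_pos hN
    have h3 := h.energy x (wls_feasible hs hb h.r_pos)
    linarith
  have hnot {s : Fin n → ℝ} {m : ℕ} (hd : ¬ (0 < m ∧ lpNorm p (fun i => s i / (m : ℝ)) ≤
      (1 + δ) * M)) : m = 0 ∨ (1 + δ) * M * m < lpNorm p s := by
    rcases Nat.eq_zero_or_pos m with h0 | h0
    · exact Or.inl h0
    · right
      have h1 : (0 : ℝ) < m := by exact_mod_cast h0
      have h2 := not_le.1 fun h' => hd ⟨h0, h'⟩
      have h3 : (fun i => s i / (m : ℝ)) = fun i => (m : ℝ)⁻¹ * s i := by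
        ext i; rw [div_eq_inv_mul]
      rw [h3, lpNorm_const_mul (by linarith), abs_of_pos (by positivity)] at h2
      rwa [inv_mul_eq_div, lt_div_iff₀ h1] at h2
  obtain ⟨u, v, huv, hu, hv⟩ := h.split
  have hTnn : 0 ≤ M * (4 / δ + √(smallStep n p ε)) := by positivity
  have hn' (i : Fin n) : (0 : ℝ) < n := by exact_mod_cast i.pos
  -- the allowance for the overloaded coordinates grows by at least the term for `log γᵢ`
  have hlog (i : Fin n) :
      st.r i ^ ((dualExp p - 1) / 2) * Real.log (n * st.r i ^ dualExp p) +
        r' i ^ ((dualExp p - 1) / 2) * Real.log (gam p δ M st.r x i) ≤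
      r' i ^ ((dualExp p - 1) / 2) * Real.log (n * r' i ^ dualExp p) := by
    have h1 : Real.log (n * r' i ^ dualExp p) =
        Real.log (n * st.r i ^ dualExp p) + Real.log (gam p δ M st.r x i) := by
      rw [hpow, ← mul_assoc, Real.log_mul (by linarith [h.r_low i]) (by linarith [hγ1 i])]
    have h2 := Real.rpow_le_rpow (h.r_pos i).le (hle i)
      (by linarith : 0 ≤ (dualExp p - 1) / 2)
    have h3 := Real.log_nonneg (h.r_low i)
    rw [h1, mul_add]
    gcongr
  have hγlog (i : Fin n) :
      0 ≤ r' i ^ ((dualExp p - 1) / 2) * Real.log (gam p δ M st.r x i) :=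
    mul_nonneg (Real.rpow_nonneg (hpos i).le _) (Real.log_nonneg (hγ1 i))
  by_cases hsmall : ∀ i, α i ≤ smallStep n p ε
  · have hnext : st.next A solve p ε δ M = ⟨r', st.s + x, st.m + 1⟩ := by
      simp only [SubState.next]
      rw [if_pos hsmall, if_pos hsmall]
    rw [hnext] at hdone ⊢
    refine ⟨l, by simp only; ring, hpos, hlow, ?_, henergy, ?_, hnot hdone, ?_⟩
    · refine h.norm_low.trans ?_
      simp only [hr', hα]
      rw [hnorm]
      linarith [Finset.sum_nonneg fun i (_ : i ∈ Finset.univ) => hterm i]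
    · simp only
      rw [mulVec_add, h.sum_feasible, hx, wls_feasible hs hb h.r_pos]
      push_cast
      rw [add_smul, one_smul]
    · let u' : Fin n → ℝ := fun i => if gam p δ M st.r x i = 1 then x i else 0
      let v' : Fin n → ℝ := fun i => if gam p δ M st.r x i = 1 then 0 else x i
      have hu' : lpNorm p u' ≤ √(1 + δ) * M := by
        refine lpNorm_le_of_forall_gam_eq_one (x := x) hp hM hδ.le h.r_pos hN fun i => ?_
        by_cases hg : gam p δ M st.r x i = 1
        · exact Or.inr ⟨if_pos hg, hg⟩
        · exact Or.inl (if_neg hg)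
      refine ⟨u + u', v + v', ?_, ?_, fun i => ?_⟩
      · ext i
        simp only [huv, Pi.add_apply, u', v']
        split_ifs <;> ring
      · refine (lpNorm_add_le (by linarith) u u').trans ?_
        push_cast
        linarith
      · have hv' : |v' i| ≤ M * (4 / δ + √(smallStep n p ε)) *
            (r' i ^ ((dualExp p - 1) / 2) * Real.log (gam p δ M st.r x i)) := by
          by_cases hg : gam p δ M st.r x i = 1
          · simp [v', hg]
          · have hg' : 1 + δ ≤ gam p δ M st.r x i :=
              ((gam_eq_one_or hM i).resolve_left fun h' => hg h'.1).1
            simp only [v', if_neg hg]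
            exact abs_le_of_one_add_le_gam hp hM hδ hδ1 h.r_pos hN1 hg' (hsmall i)
        refine (abs_add_le _ _).trans ((add_le_add (hv i) hv').trans ?_)
        rw [← mul_add]
        exact mul_le_mul_of_nonneg_left (hlog i) hTnn
  · have hnext : st.next A solve p ε δ M = ⟨r', st.s, st.m⟩ := by
      simp only [SubState.next]
      rw [if_neg hsmall, if_neg hsmall]
    rw [hnext] at hdone ⊢
    refine ⟨l + 1, by simp only; ring, hpos, hlow, ?_, henergy, h.sum_feasible, hnot hdone,
      u, v, huv, hu, fun i => (hv i).trans ?_⟩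
    · obtain ⟨j, hj⟩ := not_forall.1 hsmall
      rw [not_le] at hj
      have hT := one_le_smallStep hp j.pos hε hε1
      have hgT : smallStep n p ε ^ dualExp p ≤ gam p δ M st.r x j := by
        rw [← alph_rpow hp hM hδ.le]
        exact Real.rpow_le_rpow (by linarith) hj.le (by linarith)
      have hgδ : 1 + δ ≤ gam p δ M st.r x j := by
        refine ((gam_eq_one_or hM j).resolve_left fun h' => ?_).1
        have : α j = 1 := by rw [hα, alph, h'.1, Real.one_rpow]
        linarith
      have hgain : largeGain n p ε δ / n ≤ st.r j ^ dualExp p * (gam p δ M st.r x j - 1) := by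
        have h1 : 1 / (n : ℝ) ≤ st.r j ^ dualExp p := by
          rw [div_le_iff₀ (hn' j), mul_comm]; exact h.r_low j
        have h2 : largeGain n p ε δ ≤ gam p δ M st.r x j - 1 :=
          sub_le_sub_right (max_le hgT hgδ) 1
        calc largeGain n p ε δ / n = 1 / n * largeGain n p ε δ := by ring
          _ ≤ _ := mul_le_mul h1 h2 (largeGain_pos hδ).le (Real.rpow_nonneg (h.r_pos j).le _)
      have hsum := Finset.single_le_sum (fun i _ => hterm i) (Finset.mem_univ j)
      have := h.norm_low
      simp only [hr', hα]
      rw [hnorm]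
      push_cast
      linarith
    · exact mul_le_mul_of_nonneg_left (by linarith [hlog i, hγlog i]) hTnn

/-- A strengthening of `Outcome.Solves` for what the loop returns. -/
def Outcome.Certifies (A : Matrix (Fin d) (Fin n) ℝ) (b : Fin d → ℝ) (p ε δ M : ℝ) :
    Outcome n → Prop
  | Outcome.primal x => A *ᵥ x = b ∧ lpNorm p x ≤ (1 + δ) * M
  | Outcome.dual r => (∀ i, 0 < r i) ∧ 1 ≤ lpNorm (dualExp p) r ∧
      ∀ y : Fin n → ℝ, A *ᵥ y = b →
        (1 - ε) * M ^ 2 * lpNorm (dualExp p) r ≤ ∑ i, r i * (y i) ^ 2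

/-- If the invariant allows only `N - 1` rounds before the loop condition fails, then `N` rounds
suffice. -/
lemma subLoop_terminates (hs : IsSolver A b solve) (hb : ∃ y : Fin n → ℝ, A *ᵥ y = b)
    (hp : 2 < p) (hε : 0 < ε) (hε1 : ε ≤ 1) (hδ : 0 < δ) (hδ1 : δ ≤ 1) (hM : 0 < M) {N : ℕ}
    (hcount : ∀ (l : ℕ) (st : SubState n), SubInv A b p ε δ M l st →
      lpNorm (dualExp p) st.r ≤ 1 / ε → st.m + l < N)
    (f l : ℕ) (st : SubState n) (h : SubInv A b p ε δ M l st) (hN : st.m + l ≤ N)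
    (hf : N < f + st.m + l) :
    ∃ o c, subLoop A solve p ε δ M f st = some (o, c) ∧ o.Certifies A b p ε δ M ∧
      c + st.m + l ≤ N := by
  induction f generalizing l st with
  | zero => omega
  | succ f ih =>
    rw [subLoop_succ]
    have hq := one_lt_dualExp hp
    split_ifs with h1 h2 h3
    · have hlt := hcount l st h h1
      refine ⟨_, _, rfl, ⟨wls_feasible hs hb h.r_pos, ?_⟩, by omega⟩
      refine (lpNorm_le_of_forall_gam_eq_one hp hM hδ.le h.r_pos
        (by linarith [h.one_le_lpNorm hp hδ]) (fun i => Or.inr ⟨rfl, h2 i⟩)).trans ?_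
      gcongr
      rw [Real.sqrt_le_left (by linarith)]
      nlinarith
    · have hlt := hcount l st h h1
      refine ⟨_, _, rfl, ⟨?_, h3.2⟩, by omega⟩
      have hm : (0 : ℝ) < (st.next A solve p ε δ M).m := by exact_mod_cast h3.1
      have hfeas : A *ᵥ (st.next A solve p ε δ M).s = ((st.next A solve p ε δ M).m : ℝ) • b := by
        simp only [SubState.next]
        split_ifs
        · rw [mulVec_add, h.sum_feasible, wls_feasible hs hb h.r_pos]
          push_cast
          rw [add_smul, one_smul]
        · exact h.sum_feasible
      have h4 : (fun i => (st.next A solve p ε δ M).s i / ((st.next A solve p ε δ M).m : ℝ)) =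
          ((st.next A solve p ε δ M).m : ℝ)⁻¹ • (st.next A solve p ε δ M).s := by
        ext i; rw [Pi.smul_apply, smul_eq_mul, div_eq_inv_mul]
      rw [h4, mulVec_smul, hfeas, smul_smul, inv_mul_cancel₀ hm.ne', one_smul]
    · have hlt := hcount l st h h1
      obtain ⟨l', hl', h'⟩ := h.step hs hb hp hε hε1 hδ hδ1 hM h3
      obtain ⟨o, c, hoc, ho, hc⟩ := ih l' _ h' (by omega) (by omega)
      exact ⟨o, c + 1, by rw [hoc]; rfl, ho, by omega⟩
    · refine ⟨_, _, rfl, ⟨h.r_pos, h.one_le_lpNorm hp hδ, fun y hy => ?_⟩, by omega⟩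
      refine le_trans ?_ (h.energy y hy)
      rw [not_le, div_lt_iff₀ hε] at h1
      nlinarith [sq_nonneg M]

end Loop
/-! ### The number of rounds -/

section Count

variable {d n : ℕ} {A : Matrix (Fin d) (Fin n) ℝ} {b : Fin d → ℝ} {p ε δ M : ℝ}

/-- The bound on the number of solves in terms of the dual exponent `q`: the exponents are
`(q + 3) / 2`, `1 / (2 q + 1)` and `q (q + 2) / (2 q + 1)`. -/
lemma callBound_eq (hp : 2 < p) (hε : 0 < ε) :
    callBound n p ε =
      ((1 / ε) ^ ((dualExp p + 3) / 2) + (n : ℝ) ^ (1 / (2 * dualExp p + 1)) *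
        (1 / ε) ^ (dualExp p * (dualExp p + 2) / (2 * dualExp p + 1))) *
      Real.log (n * (1 / ε) ^ dualExp p) := by
  have h2 : p - 2 ≠ 0 := by linarith
  have h3 : 3 * p - 2 ≠ 0 := by linarith
  have h4 : 3 * p ^ 2 - 8 * p + 4 ≠ 0 := by
    rw [show 3 * p ^ 2 - 8 * p + 4 = (3 * p - 2) * (p - 2) by ring]; exact mul_ne_zero h3 h2
  have h5 : 2 * (p / (p - 2)) + 1 = (3 * p - 2) / (p - 2) := by field_simp; ring
  have e1 : (2 * p - 3) / (p - 2) = (dualExp p + 3) / 2 := by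
    rw [dualExp]; field_simp; ring
  have e2 : (p - 2) / (3 * p - 2) = 1 / (2 * dualExp p + 1) := by
    rw [dualExp, h5, one_div_div]
  have e3 : (3 * p ^ 2 - 4 * p) / (3 * p ^ 2 - 8 * p + 4) =
      dualExp p * (dualExp p + 2) / (2 * dualExp p + 1) := by
    rw [dualExp, h5, show 3 * p ^ 2 - 8 * p + 4 = (3 * p - 2) * (p - 2) by ring]
    field_simp; ring
  rw [callBound, e1, e2, e3]
  congr 2
  rw [← dualExp, Real.div_rpow zero_le_one hε.le, Real.one_rpow, mul_one_div]

lemma log_two_le (hp : 2 < p) (hn : 0 < n) (hε : 0 < ε) (hε2 : ε ≤ 1 / 2) :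
    Real.log 2 ≤ Real.log (n * (1 / ε) ^ dualExp p) := by
  have hq := one_lt_dualExp hp
  have hE : 2 ≤ 1 / ε := by rw [le_div_iff₀ hε]; linarith
  have hn1 : (1 : ℝ) ≤ n := by exact_mod_cast hn
  have h1 : (1 / ε) ^ (1 : ℝ) ≤ (1 / ε) ^ dualExp p :=
    Real.rpow_le_rpow_of_exponent_le (by linarith) hq.le
  rw [Real.rpow_one] at h1
  refine Real.log_le_log two_pos ?_
  nlinarith

lemma one_le_callBound (hp : 2 < p) (hn : 0 < n) (hε : 0 < ε) (hε2 : ε ≤ 1 / 2) :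
    1 ≤ callBound n p ε := by
  have hq := one_lt_dualExp hp
  have hE : 2 ≤ 1 / ε := by rw [le_div_iff₀ hε]; linarith
  have hL := log_two_le (p := p) hp hn hε hε2
  have h2 : (1 / ε) ^ (1 : ℝ) ≤ (1 / ε) ^ ((dualExp p + 3) / 2) :=
    Real.rpow_le_rpow_of_exponent_le (by linarith) (by linarith)
  rw [Real.rpow_one] at h2
  rw [callBound_eq hp hε]
  have h3 : 0 ≤ (n : ℝ) ^ (1 / (2 * dualExp p + 1)) *
      (1 / ε) ^ (dualExp p * (dualExp p + 2) / (2 * dualExp p + 1)) := by positivity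
  nlinarith [Real.log_two_gt_d9]

/-- While `‖r‖_q ≤ 1 / ε`, too many small updates would make the average short. -/
lemma SubInv.small_count_le (hp : 2 < p) (hε : 0 < ε) (hδ : 0 < δ)
    (hM : 0 < M) {l : ℕ} {st : SubState n} (h : SubInv A b p ε δ M l st)
    (hr : lpNorm (dualExp p) st.r ≤ 1 / ε) (hL : 0 ≤ Real.log (n * (1 / ε) ^ dualExp p)) :
    st.m * (δ / 2) ≤ (4 / δ + √(smallStep n p ε)) * Real.log (n * (1 / ε) ^ dualExp p) *
      (1 / ε) ^ ((dualExp p - 1) / 2) := by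
  have hq := one_lt_dualExp hp
  set B := Real.log (n * (1 / ε) ^ dualExp p)
  set K := 4 / δ + √(smallStep n p ε) with hK
  have hK0 : 0 ≤ K := by positivity
  rcases h.not_done with h0 | h0
  · rw [h0]; simp only [Nat.cast_zero, zero_mul]; positivity
  obtain ⟨u, v, huv, hu, hv⟩ := h.split
  have hv' : lpNorm p v ≤ M * K * B * (1 / ε) ^ ((dualExp p - 1) / 2) := by
    have h1 : lpNorm p v ≤ lpNorm p (fun i => M * K * B * st.r i ^ ((dualExp p - 1) / 2)) := by
      refine lpNorm_mono (by linarith) fun i => (hv i).trans ?_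
      have hri := h.r_pos i
      rw [abs_of_nonneg (by positivity)]
      have h2 : Real.log (n * st.r i ^ dualExp p) ≤ B := by
        refine Real.log_le_log (by linarith [h.r_low i]) ?_
        have : st.r i ≤ 1 / ε :=
          ((le_abs_self _).trans (abs_le_lpNorm (by linarith) st.r i)).trans hr
        gcongr
      calc M * K * (st.r i ^ ((dualExp p - 1) / 2) * Real.log (n * st.r i ^ dualExp p))
          ≤ M * K * (st.r i ^ ((dualExp p - 1) / 2) * B) := by gcongr
        _ = _ := by ring
    rw [lpNorm_const_mul (by linarith), lpNorm_rpow_half hp (fun i => (h.r_pos i).le),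
      abs_of_nonneg (by positivity)] at h1
    refine h1.trans ?_
    have := lpNorm_nonneg (by linarith : 0 < dualExp p) st.r
    gcongr
  have h1 := lpNorm_add_le (by linarith : 1 ≤ p) u v
  rw [← huv] at h1
  have hsq : √(1 + δ) ≤ 1 + δ / 2 := by
    rw [Real.sqrt_le_left (by linarith)]; nlinarith
  have h2 : st.m * (√(1 + δ) * M) ≤ st.m * ((1 + δ / 2) * M) := by gcongr
  have h3 : M * (st.m * (δ / 2)) ≤ M * (K * B * (1 / ε) ^ ((dualExp p - 1) / 2)) := by
    linarith
  exact le_of_mul_le_mul_left h3 hM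

/-- While `‖r‖_q ≤ 1 / ε`, the potential `‖r‖_q^q` bounds the number of large updates. -/
lemma SubInv.large_count_le (hp : 2 < p) (hn : 0 < n) {l : ℕ} {st : SubState n}
    (h : SubInv A b p ε δ M l st) (hr : lpNorm (dualExp p) st.r ≤ 1 / ε) :
    l * largeGain n p ε δ ≤ n * (1 / ε) ^ dualExp p := by
  have hq := one_lt_dualExp hp
  have hn' : (0 : ℝ) < n := by exact_mod_cast hn
  have h1 := Real.rpow_le_rpow (lpNorm_nonneg (by linarith) _) hr
    (by linarith : 0 ≤ dualExp p)
  have h2 := h.norm_low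
  have h3 : l * (largeGain n p ε δ / n) ≤ (1 / ε) ^ dualExp p := by linarith
  rwa [mul_div_assoc', div_le_iff₀ hn', mul_comm ((1 / ε) ^ _)] at h3

/-- The threshold `T` balances the two kinds of updates. -/
lemma sqrt_smallStep_mul (hp : 2 < p) (hε : 0 < ε) :
    √(smallStep n p ε) * (1 / ε) ^ ((dualExp p + 1) / 2) =
      (n : ℝ) ^ (1 / (2 * dualExp p + 1)) *
        (1 / ε) ^ (dualExp p * (dualExp p + 2) / (2 * dualExp p + 1)) := by
  have hq := one_lt_dualExp hp
  rw [smallStep, Real.sqrt_eq_rpow, Real.mul_rpow (by positivity) (by positivity),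
    ← Real.rpow_mul (by positivity), ← Real.rpow_mul (by positivity), mul_assoc,
    ← Real.rpow_add (by positivity)]
  congr 2
  · field_simp
  · field_simp; ring

lemma smallStep_rpow_mul (hp : 2 < p) (hn : 0 < n) (hε : 0 < ε) :
    smallStep n p ε ^ dualExp p * ((n : ℝ) ^ (1 / (2 * dualExp p + 1)) *
        (1 / ε) ^ (dualExp p * (dualExp p + 2) / (2 * dualExp p + 1))) =
      n * (1 / ε) ^ dualExp p := by
  have hq := one_lt_dualExp hp
  have hn' : (0 : ℝ) < n := by exact_mod_cast hn
  rw [smallStep, Real.mul_rpow (by positivity) (by positivity),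
    ← Real.rpow_mul (by positivity), ← Real.rpow_mul (by positivity), mul_mul_mul_comm,
    ← Real.rpow_add (by positivity), ← Real.rpow_add (by positivity)]
  congr 1
  · rw [← Real.rpow_one (n : ℝ), ← Real.rpow_mul hn'.le]
    congr 1; field_simp
  · congr 1; field_simp; ring

/-- If `T^q < 3/2`, then `n = 1` and `q` is so close to `1` that `(1/ε)^{(q-1)/2}` is bounded. -/
lemma of_smallStep_rpow_lt (hp : 2 < p) (hn : 0 < n) (hε : 0 < ε) (hε2 : ε ≤ 1 / 2)
    (hT : smallStep n p ε ^ dualExp p < 3 / 2) :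
    n = 1 ∧ (1 / ε) ^ ((dualExp p - 1) / 2) ≤ 9 / 4 := by
  have hq := one_lt_dualExp hp
  have hE : 1 ≤ 1 / ε := by rw [le_div_iff₀ hε]; linarith
  have hn1 : n = 1 := by
    by_contra hne
    have hn2 : (2 : ℝ) ≤ n := by exact_mod_cast (by omega : 2 ≤ n)
    have h1 : (1 : ℝ) ≤ (1 / ε) ^ ((dualExp p - 1) / (2 * dualExp p + 1)) :=
      Real.one_le_rpow hE (div_nonneg (by linarith) (by linarith))
    have h2 : (2 : ℝ) ^ (2 / (2 * dualExp p + 1)) ≤ smallStep n p ε := by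
      rw [smallStep]
      calc (2 : ℝ) ^ (2 / (2 * dualExp p + 1)) ≤ (n : ℝ) ^ (2 / (2 * dualExp p + 1)) := by gcongr
        _ ≤ _ := le_mul_of_one_le_right (by positivity) h1
    have h3 := Real.rpow_le_rpow (by positivity) h2 (by linarith : 0 ≤ dualExp p)
    rw [← Real.rpow_mul (by norm_num)] at h3
    have h4 : (2 : ℝ) ^ (2 / 3 : ℝ) ≤ 2 ^ (2 / (2 * dualExp p + 1) * dualExp p) := by
      refine Real.rpow_le_rpow_of_exponent_le (by norm_num) ?_
      rw [div_mul_eq_mul_div, div_le_div_iff₀] <;> linarith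
    have h5 : (3 / 2 : ℝ) ≤ 2 ^ (2 / 3 : ℝ) := by
      refine (Real.rpow_le_rpow_iff (by norm_num) (by positivity) (by norm_num : (0 : ℝ) < 3)).1 ?_
      rw [← Real.rpow_mul (by norm_num)]
      norm_num
    linarith
  refine ⟨hn1, ?_⟩
  have h1 : (1 / ε) ^ ((dualExp p - 1) / 2) ≤ (smallStep n p ε ^ dualExp p) ^ (3 / 2 : ℝ) := by
    rw [smallStep, hn1, Nat.cast_one, Real.one_rpow, one_mul, ← Real.rpow_mul (by positivity),
      ← Real.rpow_mul (by positivity)]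
    refine Real.rpow_le_rpow_of_exponent_le hE ?_
    rw [show (dualExp p - 1) / (2 * dualExp p + 1) * (dualExp p * (3 / 2)) =
      (dualExp p - 1) / 2 * (3 * dualExp p / (2 * dualExp p + 1)) by ring]
    refine le_mul_of_one_le_right (by linarith) ?_
    rw [le_div_iff₀] <;> linarith
  have hT0 : 0 ≤ smallStep n p ε := by rw [smallStep]; positivity
  calc (1 / ε) ^ ((dualExp p - 1) / 2) ≤ (smallStep n p ε ^ dualExp p) ^ (3 / 2 : ℝ) := h1
    _ ≤ (3 / 2) ^ (3 / 2 : ℝ) := by gcongr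
    _ ≤ (3 / 2) ^ (2 : ℝ) := Real.rpow_le_rpow_of_exponent_le (by norm_num) (by norm_num)
    _ = 9 / 4 := by norm_num

lemma SubInv.count_le (hp : 2 < p) (hn : 0 < n) (hε : 0 < ε) (hε2 : ε ≤ 1 / 2) (hM : 0 < M)
    {l : ℕ} {st : SubState n} (h : SubInv A b p ε (1 / 32 * ε) M l st)
    (hr : lpNorm (dualExp p) st.r ≤ 1 / ε) :
    (st.m + l : ℝ) ≤ 9000 * callBound n p ε := by
  have hq := one_lt_dualExp hp
  have hE : 2 ≤ 1 / ε := by rw [le_div_iff₀ hε]; linarith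
  have hlog := log_two_le (p := p) hp hn hε hε2
  have hlog2 := Real.log_two_gt_d9
  have hδ : 0 < 1 / 32 * ε := by positivity
  have hm := h.small_count_le hp hε hδ hM hr (by linarith)
  have hl := h.large_count_le hp hn hr
  have hbal := sqrt_smallStep_mul (n := n) (p := p) hp hε
  have hbal' := smallStep_rpow_mul (p := p) hp hn hε
  have hT := of_smallStep_rpow_lt (p := p) hp hn hε hε2
  have hg1 : smallStep n p ε ^ dualExp p - 1 ≤ largeGain n p ε (1 / 32 * ε) :=
    sub_le_sub_right (le_max_left _ _) 1
  have hg2 : 1 / 32 * ε ≤ largeGain n p ε (1 / 32 * ε) := by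
    rw [largeGain]
    linarith [le_max_right (smallStep n p ε ^ dualExp p) (1 + 1 / 32 * ε)]
  rw [callBound_eq hp hε]
  set L := Real.log (n * (1 / ε) ^ dualExp p)
  set E := 1 / ε with hEdef
  set q := dualExp p
  set X := E ^ ((q + 3) / 2) with hX
  set Y := (n : ℝ) ^ (1 / (2 * q + 1)) * E ^ (q * (q + 2) / (2 * q + 1)) with hY
  set Z := E ^ ((q - 1) / 2) with hZ
  have hE0 : 0 < E := by linarith
  have hX0 : 0 < X := by positivity
  have hY0 : 0 ≤ Y := by positivity
  have hZ0 : 0 < Z := by positivity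
  have hEZ : E ^ ((q + 1) / 2) = E * Z := by
    rw [hZ, ← Real.rpow_one_add' hE0.le (by linarith)]; congr 1; ring
  have hEEZ : X = E * (E * Z) := by
    rw [← hEZ, hX, ← Real.rpow_one_add' hE0.le (by linarith)]; congr 1; ring
  have hεE : ε * E = 1 := by rw [hEdef]; field_simp
  have hm' : (st.m : ℝ) ≤ 8192 * (X * L) + 64 * (Y * L) := by
    have h1 : (st.m : ℝ) = 64 * E * (st.m * (1 / 32 * ε / 2)) := by
      linear_combination (-(st.m : ℝ)) * hεE
    have h2 : 4 / (1 / 32 * ε) = 128 * E := by rw [hEdef]; field_simp; norm_num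
    rw [h2] at hm
    rw [h1, ← hbal, hEZ, hEEZ]
    calc _ ≤ 64 * E * ((128 * E + √(smallStep n p ε)) * L * Z) := by gcongr
      _ = _ := by ring
  have hl' : (l : ℝ) ≤ 72 * X + 3 * Y := by
    rcases lt_or_ge (smallStep n p ε ^ q) (3 / 2) with hc | hc
    · obtain ⟨hn1, hZ9⟩ := hT hc
      have h1 : l * (1 / 32 * ε) ≤ n * E ^ q :=
        (mul_le_mul_of_nonneg_left hg2 (Nat.cast_nonneg l)).trans hl
      have h2 : E ^ q = E * (Z * Z) := by
        rw [hZ, ← Real.rpow_add hE0, ← Real.rpow_one_add' hE0.le (by linarith)]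
        congr 1; ring
      rw [hn1, Nat.cast_one, one_mul, h2] at h1
      have h3 : (l : ℝ) = 32 * E * (l * (1 / 32 * ε)) := by
        linear_combination (-(l : ℝ)) * hεE
      rw [h3, hEEZ]
      calc _ ≤ 32 * E * (E * (Z * Z)) := by gcongr
        _ ≤ 32 * E * (E * (9 / 4 * Z)) := by gcongr
        _ = 72 * (E * (E * Z)) := by ring
        _ ≤ _ := by linarith
    · have h1 : smallStep n p ε ^ q * l ≤ smallStep n p ε ^ q * (3 * Y) := by
        have : (l : ℝ) * (smallStep n p ε ^ q - 1) ≤ smallStep n p ε ^ q * Y := by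
          rw [hbal']
          exact (mul_le_mul_of_nonneg_left hg1 (Nat.cast_nonneg l)).trans hl
        have h2 : (l : ℝ) * (3 / 2) ≤ l * smallStep n p ε ^ q := by gcongr
        linarith
      linarith [le_of_mul_le_mul_left h1 (by linarith)]
  nlinarith [mul_nonneg hX0.le (by linarith : 0 ≤ L - 1 / 2),
    mul_nonneg hY0 (by linarith : 0 ≤ L - 1 / 2)]

end Count
/-! ### The binary search -/

section Search

variable {d n : ℕ} {A : Matrix (Fin d) (Fin n) ℝ} {b : Fin d → ℝ}
  {solve : (Fin n → ℝ) → (Fin d → ℝ)} {p ε δ M : ℝ}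

lemma subSolver_terminates (hs : IsSolver A b solve) (hb : ∃ y : Fin n → ℝ, A *ᵥ y = b)
    (hp : 2 < p) (hn : 0 < n) (hε : 0 < ε) (hε2 : ε ≤ 1 / 2) (hM : 0 < M) {f : ℕ}
    (hf : ⌊9000 * callBound n p ε⌋₊ + 1 < f) :
    ∃ o c, subSolver A solve p ε (1 / 32 * ε) M f = some (o, c) ∧
      o.Certifies A b p ε (1 / 32 * ε) M ∧ (c : ℝ) ≤ 9001 * callBound n p ε := by
  have hcb := one_le_callBound (p := p) hp hn hε hε2
  obtain ⟨o, c, h1, h2, h3⟩ := subLoop_terminates (δ := 1 / 32 * ε) hs hb hp hε (by linarith)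
    (by positivity) (by linarith) hM
    (N := ⌊9000 * callBound n p ε⌋₊ + 1)
    (fun l st h hr => Nat.lt_succ_of_le (Nat.le_floor (by
      push_cast; exact h.count_le hp hn hε hε2 hM hr)))
    f 0 _ (SubInv.initial hp hn) (Nat.zero_le _) hf
  refine ⟨o, c, h1, h2, ?_⟩
  have h4 : (c : ℝ) ≤ (⌊9000 * callBound n p ε⌋₊ + 1 : ℕ) := by exact_mod_cast h3
  have h5 := Nat.floor_le (show 0 ≤ 9000 * callBound n p ε by linarith)
  push_cast at h4
  linarith

lemma Outcome.Certifies.le_lpNorm_sq (hp : 2 < p) {r : Fin n → ℝ}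
    (h : (Outcome.dual r).Certifies A b p ε δ M) {y : Fin n → ℝ} (hy : A *ᵥ y = b) :
    (1 - ε) * M ^ 2 ≤ lpNorm p y ^ 2 := by
  have h1 := (h.2.2 y hy).trans (sum_mul_sq_le hp r y)
  rw [mul_comm] at h1
  exact le_of_mul_le_mul_left h1 (by linarith [h.2.1])

lemma Outcome.Certifies.solves (hp : 2 < p) (hε : 0 < ε) (hε2 : ε ≤ 1 / 2) (hδε : δ ≤ ε)
    (hM : 0 < M) {o : Outcome n} (h : o.Certifies A b p ε δ M) : o.Solves A b p ε M := by
  have hq := one_lt_dualExp hp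
  cases o with
  | primal x => exact ⟨h.1, h.2.trans (by gcongr)⟩
  | dual r =>
    refine ⟨fun i => (h.1 i).le, ?_, fun y hy => le_trans ?_ (h.2.2 y hy)⟩
    · rintro rfl
      have := h.2.1
      rw [lpNorm_zero (by linarith)] at this
      linarith
    · have h1 : (M / (1 + ε)) ^ 2 ≤ (1 - ε) * M ^ 2 := by
        rw [div_pow, div_le_iff₀ (by positivity)]
        have : 1 ≤ (1 - ε) * (1 + ε) ^ 2 := by nlinarith [mul_pos hε hε]
        nlinarith [sq_nonneg M]
      exact mul_le_mul_of_nonneg_right h1 (by linarith [h.2.1])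

/-- The search keeps `‖x‖_p ≤ (1 + δ)^(U + 1)` and a lower bound of `√(1 - ε) (1 + δ)^(L - 1)` on the
optimum, and halves the number of candidate guesses in each round. -/
lemma searchLoop_spec (hp : 2 < p) (hδ : 0 < δ) (hε1 : ε ≤ 1) {sf : ℕ} {B : ℝ}
    (hsub : ∀ M : ℝ, 0 < M → ∃ o c, subSolver A solve p ε δ M sf = some (o, c) ∧
      o.Certifies A b p ε δ M ∧ (c : ℝ) ≤ B)
    (k f : ℕ) (hf : k < f) (L U : ℤ) (x : Fin n → ℝ) (hLU : L ≤ U) (hk : U - L + 1 ≤ 2 ^ k)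
    (hx : A *ᵥ x = b) (hxU : lpNorm p x ≤ (1 + δ) * (1 + δ) ^ U)
    (hopt : ∀ y, A *ᵥ y = b → (1 - ε) * ((1 + δ) ^ (L - 1)) ^ 2 ≤ lpNorm p y ^ 2) :
    ∃ x' subs, searchLoop A solve p ε δ sf f L U x = some (x', subs) ∧ A *ᵥ x' = b ∧
      (∀ y, A *ᵥ y = b → (1 - ε) * lpNorm p x' ^ 2 ≤ (1 + δ) ^ 4 * lpNorm p y ^ 2) ∧
      subs.length ≤ k ∧
      ∀ sc ∈ subs, 0 < sc.guess ∧ sc.outcome.Certifies A b p ε δ sc.guess ∧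
        (sc.calls : ℝ) ≤ B := by
  have hδ1 : 0 < 1 + δ := by linarith
  induction k generalizing f L U x with
  | zero =>
    obtain ⟨f, rfl⟩ := Nat.exists_eq_succ_of_ne_zero (by omega : f ≠ 0)
    have hLU' : ¬ L < U := by simp at hk; omega
    refine ⟨x, [], by rw [searchLoop, if_neg hLU'], hx, fun y hy => ?_, le_rfl, by simp⟩
    have hUL : U = L - 1 + 1 := by omega
    rw [hUL, zpow_add_one₀ hδ1.ne'] at hxU
    have h1 := pow_le_pow_left₀ (lpNorm_nonneg (by linarith) x) hxU 2
    calc (1 - ε) * lpNorm p x ^ 2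
        ≤ (1 - ε) * ((1 + δ) * ((1 + δ) ^ (L - 1) * (1 + δ))) ^ 2 :=
          mul_le_mul_of_nonneg_left h1 (by linarith)
      _ = (1 + δ) ^ 4 * ((1 - ε) * ((1 + δ) ^ (L - 1)) ^ 2) := by ring
      _ ≤ _ := mul_le_mul_of_nonneg_left (hopt y hy) (by positivity)
  | succ k ih =>
    obtain ⟨f, rfl⟩ := Nat.exists_eq_succ_of_ne_zero (by omega : f ≠ 0)
    rw [pow_succ] at hk
    by_cases hlt : L < U
    · have hM : 0 < (1 + δ) ^ ((L + U) / 2) := zpow_pos hδ1 _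
      obtain ⟨o, c, hoc, ho, hc⟩ := hsub _ hM
      rw [searchLoop, if_pos hlt]
      simp only [hoc]
      cases o with
      | primal y =>
        obtain ⟨x', subs, h1, h2, h3, h4, h5⟩ := ih f (by omega) L ((L + U) / 2) y
          (by omega) (by omega) ho.1 ho.2 hopt
        refine ⟨x', ⟨(1 + δ) ^ ((L + U) / 2), Outcome.primal y, c⟩ :: subs, ?_, h2, h3, by simpa using h4, ?_⟩
        · exact congrArg (Option.map _) h1
        simp only [List.mem_cons, forall_eq_or_imp]
        exact ⟨⟨hM, ho, hc⟩, h5⟩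
      | dual r =>
        obtain ⟨x', subs, h1, h2, h3, h4, h5⟩ := ih f (by omega) ((L + U) / 2 + 1) U x
          (by omega) (by omega) hx hxU (fun y hy => by
            rw [add_sub_cancel_right]; exact ho.le_lpNorm_sq hp hy)
        refine ⟨x', ⟨(1 + δ) ^ ((L + U) / 2), Outcome.dual r, c⟩ :: subs, ?_, h2, h3, by simpa using h4, ?_⟩
        · exact congrArg (Option.map _) h1
        simp only [List.mem_cons, forall_eq_or_imp]
        exact ⟨⟨hM, ho, hc⟩, h5⟩
    · have hUL : U = L := by omega
      have hpos : (0 : ℤ) < 2 ^ k := by positivity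
      obtain ⟨x', subs, h1, h2, h3, h4, h5⟩ := ih (f + 1) (by omega) L U x hLU (by omega)
        hx hxU hopt
      exact ⟨x', subs, h1, h2, h3, h4.trans (Nat.le_succ k), h5⟩

/-- For `n = 2` the number `log (log n)` is negative, but small compared with `log (1 / ε)`; for
`n ≤ 1` it is `0` by the conventions `log 1 = 0` and `log 0 = 0`. -/
lemma log_add_log_max_le (n : ℕ) (hε : 0 < ε) (hε2 : ε ≤ 1 / 2) :
    Real.log (1 / ε) + Real.log (max (Real.log n) 1) ≤
      4 * (Real.log (Real.log n) + Real.log (1 / ε)) := by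
  have hlog2 := Real.log_two_gt_d9
  have hlog2' := Real.log_two_lt_d9
  have hE : Real.log 2 ≤ Real.log (1 / ε) :=
    Real.log_le_log two_pos (by rw [le_div_iff₀ hε]; linarith)
  match n with
  | 0 => simp at hE ⊢; linarith
  | 1 => simp at hE ⊢; linarith
  | 2 =>
    have h1 := Real.one_sub_inv_le_log_of_pos (x := Real.log 2) (by linarith)
    have h2 : (Real.log 2)⁻¹ ≤ 1.45 := by
      rw [inv_le_comm₀ (by linarith) (by norm_num)]; norm_num; linarith
    rw [Nat.cast_ofNat, max_eq_right (by linarith), Real.log_one]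
    linarith
  | n + 3 =>
    have h1 : 1 ≤ Real.log ((n + 3 : ℕ) : ℝ) := by
      rw [Real.le_log_iff_exp_le (by positivity)]
      push_cast
      linarith [Real.exp_one_lt_d9, (Nat.cast_nonneg n : (0 : ℝ) ≤ n)]
    have h2 := Real.log_nonneg h1
    rw [max_eq_left h1]
    linarith

lemma exists_two_pow_ge (n : ℕ) (hε : 0 < ε) (hε2 : ε ≤ 1 / 2) :
    ∃ k : ℕ, 3 + 32 / ε * Real.log n ≤ 2 ^ k ∧
      (k : ℝ) ≤ 64 * (Real.log (Real.log n) + Real.log (1 / ε)) := by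
  have hF := log_add_log_max_le n hε hε2
  have hlog2 := Real.log_two_gt_d9
  have hE2 : 2 ≤ 1 / ε := by rw [le_div_iff₀ hε]; linarith
  have hE : Real.log 2 ≤ Real.log (1 / ε) := Real.log_le_log two_pos hE2
  set m := max (Real.log n) 1 with hm
  have hm1 : 1 ≤ m := le_max_right _ _
  have hm2 : Real.log n ≤ m := le_max_left _ _
  have hW : 3 + 32 / ε * Real.log n ≤ 64 * (1 / ε * m) := by
    have h1 : 32 / ε * Real.log n ≤ 32 / ε * m := by gcongr
    have h2 : 2 * 1 ≤ 1 / ε * m := mul_le_mul hE2 hm1 zero_le_one (by positivity)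
    have h3 : 32 / ε * m = 32 * (1 / ε * m) := by ring
    linarith
  have hpos : 0 < 64 * (1 / ε * m) := by positivity
  have h64 : Real.log 64 = 6 * Real.log 2 := by
    rw [show (64 : ℝ) = 2 ^ 6 by norm_num, Real.log_pow]; norm_num
  have hlogW : Real.log (64 * (1 / ε * m)) = 6 * Real.log 2 + (Real.log (1 / ε) + Real.log m) := by
    rw [Real.log_mul (by norm_num) (by positivity),
      Real.log_mul (by positivity) (by positivity), h64]
  have hlogm := Real.log_nonneg hm1
  refine ⟨⌈Real.logb 2 (64 * (1 / ε * m))⌉₊, hW.trans ?_, ?_⟩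
  · have h1 := Nat.le_ceil (Real.logb 2 (64 * (1 / ε * m)))
    rw [Real.logb_le_iff_le_rpow one_lt_two hpos, Real.rpow_natCast] at h1
    exact h1
  · have h0 : 0 ≤ Real.logb 2 (64 * (1 / ε * m)) := by
      rw [Real.logb, hlogW]
      exact div_nonneg (by linarith) (by linarith)
    have h1 := (Nat.ceil_lt_add_one h0).le
    have h2 : Real.logb 2 (64 * (1 / ε * m)) ≤ 6 + 2 * (Real.log (1 / ε) + Real.log m) := by
      rw [Real.logb, hlogW, div_le_iff₀ (by linarith)]
      nlinarith
    linarith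

lemma floor_ceil_range (hp : 2 < p) (hn : 0 < n) (hδ : 0 < δ) (hδ1 : δ ≤ 1) {a : ℝ} (ha : 0 < a) :
    ⌊Real.logb (1 + δ) (a / (n : ℝ) ^ (1 / 2 - 1 / p))⌋ ≤ ⌈Real.logb (1 + δ) a⌉ ∧
      ((⌈Real.logb (1 + δ) a⌉ - ⌊Real.logb (1 + δ) (a / (n : ℝ) ^ (1 / 2 - 1 / p))⌋ + 1 : ℤ) : ℝ) ≤
        3 + 1 / δ * Real.log n := by
  have hn1 : (1 : ℝ) ≤ n := by exact_mod_cast hn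
  have hlogn := Real.log_nonneg hn1
  have hl := log_one_add_ge hδ.le hδ1
  have h1p : 0 < 1 / p := by positivity
  have h1p' : 1 / p ≤ 1 / 2 := one_div_le_one_div_of_le two_pos hp.le
  have h1 : Real.logb (1 + δ) (a / (n : ℝ) ^ (1 / 2 - 1 / p)) =
      Real.logb (1 + δ) a - (1 / 2 - 1 / p) * Real.log n / Real.log (1 + δ) := by
    rw [Real.logb_div ha.ne' (by positivity)]
    congr 1
    rw [Real.logb, Real.log_rpow (by linarith)]
  have h2 : 0 ≤ (1 / 2 - 1 / p) * Real.log n / Real.log (1 + δ) :=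
    div_nonneg (mul_nonneg (by linarith) hlogn) (by linarith)
  have h3 : (1 / 2 - 1 / p) * Real.log n / Real.log (1 + δ) ≤ 1 / δ * Real.log n := by
    calc (1 / 2 - 1 / p) * Real.log n / Real.log (1 + δ) ≤ 1 / 2 * Real.log n / (δ / 2) := by
          gcongr; linarith
      _ = 1 / δ * Real.log n := by field_simp
  rw [h1]
  refine ⟨(Int.floor_mono (by linarith)).trans (Int.floor_le_ceil _), ?_⟩
  have h4 := Int.ceil_lt_add_one (Real.logb (1 + δ) a)
  have h5 := Int.lt_floor_add_one
    (Real.logb (1 + δ) a - (1 / 2 - 1 / p) * Real.log n / Real.log (1 + δ))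
  push_cast
  linarith

end Search

end IRLS

open IRLS in
theorem theorem1 :
    ∃ c C : ℝ, 0 < c ∧ c ≤ 1 ∧ 0 < C ∧
      ∀ (p : ℝ), 2 ≤ p →
      ∀ (d n : ℕ) (A : Matrix (Fin d) (Fin n) ℝ) (b : Fin d → ℝ),
        (∃ y : Fin n → ℝ, A *ᵥ y = b) →
      ∀ (ε : ℝ), 0 < ε → ε ≤ 1 / 2 →
      ∀ (solve : (Fin n → ℝ) → (Fin d → ℝ)), IRLS.IsSolver A b solve →
        ∃ (fuel : ℕ) (x : Fin n → ℝ) (subs : List (IRLS.SubCall n)),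
          IRLS.lpMin A solve p ε (c * ε) fuel = some (x, subs) ∧
          A *ᵥ x = b ∧
          (∀ y : Fin n → ℝ, A *ᵥ y = b → IRLS.lpNorm p x ≤ (1 + ε) * IRLS.lpNorm p y) ∧
          (subs.length : ℝ) ≤ C * (Real.log (Real.log n) + Real.log (1 / ε)) ∧
          (p = 2 → subs = []) ∧
          (2 < p → ∀ sc ∈ subs,
            sc.outcome.Solves A b p ε sc.guess ∧
            (sc.calls : ℝ) ≤ C * IRLS.callBound n p ε) := by
  refine ⟨1 / 32, 9001, by norm_num, by norm_num, by norm_num, ?_⟩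
  intro p hp d n A b hb ε hε hε2 solve hs
  obtain ⟨k, hk, hkF⟩ := exists_two_pow_ge n hε hε2
  have hF : (k : ℝ) ≤ 9001 * (Real.log (Real.log n) + Real.log (1 / ε)) := by
    have : (0 : ℝ) ≤ k := Nat.cast_nonneg k
    linarith
  set x₀ := wls A solve (fun _ => 1) with hx₀
  have hfeas : A *ᵥ x₀ = b := wls_feasible hs hb fun _ => one_pos
  by_cases hc : p = 2 ∨ x₀ = 0
  · refine ⟨0, x₀, [], if_pos hc, hfeas, fun y hy => ?_, ?_, fun _ => rfl, by simp⟩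
    · have hy0 := lpNorm_nonneg (by linarith : 0 < p) y
      have h1 : lpNorm p x₀ ≤ lpNorm p y := by
        rcases hc with rfl | h0
        · exact lpNorm_two_wls_le hs hb hy
        · rwa [h0, lpNorm_zero (by linarith)]
      nlinarith
    · rw [List.length_nil, Nat.cast_zero]
      exact (Nat.cast_nonneg k).trans hF
  obtain ⟨hp2, hx0⟩ := not_or.1 hc
  have hp' : 2 < p := lt_of_le_of_ne hp (Ne.symm hp2)
  have hn : 0 < n := by
    obtain ⟨i, _⟩ := Function.ne_iff.1 hx0
    exact i.pos
  have ha : 0 < lpNorm 2 x₀ := lpNorm_pos two_pos hx0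
  have hδ : 0 < 1 / 32 * ε := by positivity
  have hδ1 : 0 < 1 + 1 / 32 * ε := by positivity
  obtain ⟨hLU, hrange⟩ := floor_ceil_range hp' hn hδ (by linarith) ha
  set L := ⌊Real.logb (1 + 1 / 32 * ε) (lpNorm 2 x₀ / (n : ℝ) ^ (1 / 2 - 1 / p))⌋ with hL
  set U := ⌈Real.logb (1 + 1 / 32 * ε) (lpNorm 2 x₀)⌉ with hU
  have hkZ : U - L + 1 ≤ 2 ^ k := by
    have h1 : 1 / (1 / 32 * ε) = 32 / ε := by field_simp
    rw [h1] at hrange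
    exact_mod_cast hrange.trans hk
  have hxU : lpNorm p x₀ ≤ (1 + 1 / 32 * ε) * (1 + 1 / 32 * ε) ^ U := by
    have h1 : lpNorm 2 x₀ ≤ (1 + 1 / 32 * ε) ^ U := by
      rw [← Real.rpow_intCast, ← Real.logb_le_iff_le_rpow (by linarith) ha]
      exact Int.le_ceil _
    have h2 := lpNorm_le_lpNorm_two hp x₀
    nlinarith
  have hopt : ∀ y, A *ᵥ y = b →
      (1 - ε) * ((1 + 1 / 32 * ε) ^ (L - 1)) ^ 2 ≤ lpNorm p y ^ 2 := by
    intro y hy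
    have h1 : (1 + 1 / 32 * ε) ^ L ≤ lpNorm 2 x₀ / (n : ℝ) ^ (1 / 2 - 1 / p) := by
      have hn' : (0 : ℝ) < n := by exact_mod_cast hn
      rw [← Real.rpow_intCast, ← Real.le_logb_iff_rpow_le (by linarith) (by positivity)]
      exact Int.floor_le _
    have h2 : lpNorm 2 x₀ / (n : ℝ) ^ (1 / 2 - 1 / p) ≤ lpNorm p y := by
      refine le_trans ?_ (lpNorm_two_le hp' hn y)
      have := lpNorm_two_wls_le hs hb hy
      gcongr
    have h3 : (1 + 1 / 32 * ε) ^ (L - 1) ≤ (1 + 1 / 32 * ε) ^ L :=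
      zpow_le_zpow_right₀ (by linarith) (by omega)
    have h4 : 0 < (1 + 1 / 32 * ε) ^ (L - 1) := zpow_pos hδ1 _
    have h5 := pow_le_pow_left₀ h4.le ((h3.trans h1).trans h2) 2
    nlinarith [sq_nonneg ((1 + 1 / 32 * ε) ^ (L - 1))]
  set f := max (⌊9000 * callBound n p ε⌋₊ + 2) (k + 1) with hf
  obtain ⟨x, subs, h1, h2, h3, h4, h5⟩ := searchLoop_spec (sf := f)
    hp' hδ (by linarith)
    (fun M hM => subSolver_terminates hs hb hp' hn hε hε2 hM (by omega)) k f (by omega) L U x₀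
    hLU hkZ hfeas hxU hopt
  refine ⟨f, x, subs, ?_, h2, fun y hy => ?_, ?_, fun h => absurd h hp2, fun _ sc hsc => ?_⟩
  · exact (if_neg hc).trans h1
  · have h6 := h3 y hy
    have hx := lpNorm_nonneg (by linarith : 0 < p) x
    have hy := lpNorm_nonneg (by linarith : 0 < p) y
    have h7 : (1 + 1 / 32 * ε) ^ 4 ≤ (1 - ε) * (1 + ε) ^ 2 := by
      have e1 : (1 + 1 / 32 * ε) ^ 2 ≤ 1 + ε / 12 := by nlinarith
      have e2 : (1 + 1 / 32 * ε) ^ 4 ≤ (1 + ε / 12) ^ 2 := by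
        rw [show (1 + 1 / 32 * ε) ^ 4 = ((1 + 1 / 32 * ε) ^ 2) ^ 2 by ring]
        gcongr
      have e3 : ε * (ε + ε ^ 2) ≤ ε * (3 / 4) := by gcongr; nlinarith
      nlinarith
    have h8 : (1 - ε) * lpNorm p x ^ 2 ≤ (1 - ε) * ((1 + ε) * lpNorm p y) ^ 2 := by
      have := mul_le_mul_of_nonneg_right h7 (sq_nonneg (lpNorm p y))
      linarith
    have h9 := le_of_mul_le_mul_left h8 (by linarith)
    exact (pow_le_pow_iff_left₀ hx (by positivity) two_ne_zero).1 h9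
  · exact le_trans (by exact_mod_cast h4) hF
  · obtain ⟨h6, h7, h8⟩ := h5 sc hsc
    exact ⟨h7.solves hp' hε hε2 (by linarith) h6, h8⟩
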